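/- Let $n\ge 0$, $S=\mathbb{C}[x_0,\ldots,x_n]$, and let $T=\mathbb{C}[y_0,\ldots,y_n]$ act on $S$ by differentiation, $y_i=\partial/\partial x_i$. For a form $F\in S$ put $F^{\perp}=\{g\in T : g(F)=0\}$. A closed subscheme $\Gamma\subset\mathbb{P}^n=\operatorname{Proj} T$ with saturated homogeneous ideal $I_\Gamma\subset T$ is called apolar to $F$ if $I_\Gamma\subset F^{\perp}$. The cactus rank $cr(F)$ is the minimal length of a zero-dimensional closed subscheme $\Gamma\subset\mathbb{P}^n$ apolar to $F$, and the smoothable rank $sr(F)$ is the minimal length of such a $\Gamma$ which is moreover smoothable, that is, a flat limit in $\mathbb{P}^n$ of smooth zero-dimensional subschemes. "General" means: for all members of some nonempty Zariski-open subset of the family considered. **Theorem.** (a) For a general cubic form $F\in\mathbb{C}[x_0,\ldots,x_n]$ one has $cr(F)\le 2n+2$. (b) If $n>1$, then for a general reducible cubic form $F\in\mathbb{C}[x_0,\ldots,x_n]$ one has $$cr(F)=sr(F)=n+2.$$ -/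

import Mathlib

open MvPolynomial

section Cactus

/-- The coordinate ring `R[y_0, …, y_n]` of projective `n`-space over `R`. -/
abbrev CoordRing (R : Type*) [CommSemiring R] (n : ℕ) : Type _ :=
  MvPolynomial (Fin (n + 1)) R

/-- The irrelevant ideal `(y_0, …, y_n)`. -/
noncomputable def irrelevantIdeal (R : Type*) [CommRing R] (n : ℕ) : Ideal (CoordRing R n) :=
  Ideal.span (Set.range fun i : Fin (n + 1) => (X i : CoordRing R n))

/-- The ideal `I` is homogeneous: it contains the homogeneous components of its elements. -/
def IsHomogeneousIdeal {R : Type*} [CommRing R] {n : ℕ} (I : Ideal (CoordRing R n)) : Prop :=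
  ∀ g ∈ I, ∀ d : ℕ, homogeneousComponent d g ∈ I

/-- The saturation `⋃_m (I : 𝔪 ^ m)` of an ideal `I` with respect to the irrelevant ideal `𝔪`. -/
noncomputable def saturation {R : Type*} [CommRing R] {n : ℕ} (I : Ideal (CoordRing R n)) :
    Ideal (CoordRing R n) where
  carrier := {g | ∃ m : ℕ, ∀ p ∈ irrelevantIdeal R n ^ m, p * g ∈ I}
  zero_mem' := ⟨0, fun p _ => by simp⟩
  add_mem' := by
    rintro a b ⟨m, hm⟩ ⟨k, hk⟩
    refine ⟨m + k, fun p hp => ?_⟩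
    rw [mul_add]
    exact I.add_mem (hm p (Ideal.pow_le_pow_right (Nat.le_add_right m k) hp))
      (hk p (Ideal.pow_le_pow_right (Nat.le_add_left k m) hp))
  smul_mem' := by
    rintro c a ⟨m, hm⟩
    refine ⟨m, fun p hp => ?_⟩
    rw [smul_eq_mul, mul_left_comm]
    exact I.mul_mem_left c (hm p hp)

/-- Saturated homogeneous ideals of `R[y_0, …, y_n]`: they correspond bijectively to the closed
subschemes `Z` of projective `n`-space over the Noetherian ring `R`, by sending `Z` to its
homogeneous ideal `I_Z`. -/
def IsSubschemeIdeal {R : Type*} [CommRing R] {n : ℕ} (I : Ideal (CoordRing R n)) : Prop :=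
  IsHomogeneousIdeal I ∧ saturation I = I

/-- The Hilbert function `d ↦ dim (k[y_0, …, y_n] / I)_d` of a homogeneous ideal. -/
noncomputable def hilbertFunction {k : Type*} [Field k] {n : ℕ} (I : Ideal (CoordRing k n))
    (d : ℕ) : ℕ :=
  Module.finrank k (homogeneousSubmodule (Fin (n + 1)) k d ⧸
    (I.restrictScalars k).submoduleOf (homogeneousSubmodule (Fin (n + 1)) k d))

/-- `I` is the homogeneous ideal of a closed subscheme of projective `n`-space over `k` which has
dimension `0` and length `r`: its Hilbert polynomial is the nonzero constant `r`. -/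
def IsZeroDimOfLength {k : Type*} [Field k] {n : ℕ} (I : Ideal (CoordRing k n)) (r : ℕ) : Prop :=
  IsSubschemeIdeal I ∧ 0 < r ∧ ∃ d₀ : ℕ, ∀ d ≥ d₀, hilbertFunction I d = r

/-- The operator `∂^m = ∂_0^(m 0) ⋯ ∂_n^(m n)` on polynomials (the partial derivatives commute). -/
noncomputable def monomialDerivative {n : ℕ} (m : Fin (n + 1) →₀ ℕ) :
    Module.End ℂ (MvPolynomial (Fin (n + 1)) ℂ) :=
  (List.ofFn fun i : Fin (n + 1) => ((pderiv i : Derivation ℂ (MvPolynomial (Fin (n + 1)) ℂ)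
    (MvPolynomial (Fin (n + 1)) ℂ)).toLinearMap : Module.End ℂ _) ^ m i).prod

/-- The action of `g ∈ ℂ[y_0, …, y_n]` on `F ∈ ℂ[x_0, …, x_n]` by differentiation, the variable
`y_i` acting as `∂/∂x_i`. -/
noncomputable def diffAction {n : ℕ} (g : CoordRing ℂ n) (F : MvPolynomial (Fin (n + 1)) ℂ) :
    MvPolynomial (Fin (n + 1)) ℂ :=
  ∑ m ∈ g.support, coeff m g • monomialDerivative m F

/-- `I ⊆ F^⊥`: the ideal is contained in the annihilator of `F`. -/
def IsApolar {n : ℕ} (I : Ideal (CoordRing ℂ n)) (F : MvPolynomial (Fin (n + 1)) ℂ) : Prop :=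
  ∀ g ∈ I, diffAction g F = 0

/-- Smoothability of the subscheme `Γ` of complex projective space with homogeneous ideal `I`,
for `Γ` of dimension `0`: there is a closed subscheme of projective `n`-space over `ℂ⟦t⟧`, with
homogeneous ideal `J`, which is flat over `ℂ⟦t⟧`, has special fibre `Γ` and has a smooth generic
fibre. The generic fibre has dimension `0` over a field of characteristic `0`, so that smooth means
reduced. -/
def IsSmoothable {n : ℕ} (I : Ideal (CoordRing ℂ n)) : Prop :=
  ∃ J : Ideal (CoordRing (PowerSeries ℂ) n),
    IsSubschemeIdeal J ∧
    Module.Flat (PowerSeries ℂ) (CoordRing (PowerSeries ℂ) n ⧸ J) ∧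
    saturation (J.map (MvPolynomial.map (PowerSeries.constantCoeff (R := ℂ)))) = I ∧
    (J.map (MvPolynomial.map (algebraMap (PowerSeries ℂ) (LaurentSeries ℂ)))).IsRadical

/-- The cactus rank: the minimal length of a zero-dimensional subscheme apolar to `F`
(it is `⊤` if there is none). -/
noncomputable def cactusRank {n : ℕ} (F : MvPolynomial (Fin (n + 1)) ℂ) : ℕ∞ :=
  ⨅ r ∈ {r : ℕ | ∃ I : Ideal (CoordRing ℂ n), IsZeroDimOfLength I r ∧ IsApolar I F}, (r : ℕ∞)

/-- The smoothable rank: the minimal length of a smoothable zero-dimensional subscheme apolar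
to `F` (it is `⊤` if there is none). -/
noncomputable def smoothableRank {n : ℕ} (F : MvPolynomial (Fin (n + 1)) ℂ) : ℕ∞ :=
  ⨅ r ∈ {r : ℕ | ∃ I : Ideal (CoordRing ℂ n),
    IsZeroDimOfLength I r ∧ IsSmoothable I ∧ IsApolar I F}, (r : ℕ∞)

/-- The cubic forms in `x_0, …, x_n`. -/
def cubicForms (n : ℕ) : Set (MvPolynomial (Fin (n + 1)) ℂ) :=
  {F | F.IsHomogeneous 3}

/-- The (nonzero) reducible cubic forms in `x_0, …, x_n`. -/
def reducibleCubicForms (n : ℕ) : Set (MvPolynomial (Fin (n + 1)) ℂ) :=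
  {F | F.IsHomogeneous 3 ∧ F ≠ 0 ∧ ¬ Irreducible F}

/-- `Q` holds for a general member of the (irreducible) family `V` of polynomials: it holds on a
nonempty Zariski-open subset of `V`, namely on a subset where some polynomial `P` in the
coefficients is nonzero. -/
def HoldsForGeneral {n : ℕ} (V : Set (MvPolynomial (Fin (n + 1)) ℂ))
    (Q : MvPolynomial (Fin (n + 1)) ℂ → Prop) : Prop :=
  ∃ P : MvPolynomial (Fin (n + 1) →₀ ℕ) ℂ,
    (∃ F ∈ V, eval (fun m => coeff m F) P ≠ 0) ∧
    ∀ F ∈ V, eval (fun m => coeff m F) P ≠ 0 → Q F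

end Cactus

/-!
Write `T = ℂ[y_0, …, y_n]`. Since an ideal is stable under multiplication, apolarity of `I` to `F`
means that the functional `Φ_F(g) = g(F)(0)` vanishes on `I` (`isApolar_iff`), and for a cubic form
only the values of `Φ_F` on forms of degree `3` matter.

All schemes are produced in the same way. A point `a` of affine `(n + 1)`-space with values in
a `k`-algebra `A` has a homogeneous ideal `projIdeal a`, the kernel of `g ↦ ∑_d g_d(a) X ^ d`. If
some linear form takes the value `1` at `a` this ideal is saturated, and if moreover `A` is finite
dimensional and generated by the coordinates of `a`, then it defines a scheme of length `dim A`
(`isZeroDimOfLength_projIdeal`).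

For the first part let `ψ` be the functional on `ℂ[s_1, …, s_n]` obtained from `Φ_F` by
dehomogenization and cut off in degrees above `3`, and let `A` be the quotient by the largest ideal
in the kernel of `ψ`. The corresponding local Gorenstein scheme is apolar to `F`. Its length is the
rank of the form `ψ(f h)`, which vanishes on the subspace of elements without terms of degree at
most `1`, of codimension `n + 1`. So the length is at most `2 (n + 1)`. The scheme is nonempty
when `F` contains `x_0 ^ 3`.

For the second part let `F = l q`. If `q` is nondegenerate on the hyperplane `l = 0`, there are
coordinates in which `F = x_0 (c x_0 ^ 2 + x_1 ^ 2 + ⋯ + x_n ^ 2)` up to constant factors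
(`exists_basis_diagonal`, `IsNormalized`). This condition follows from an open one: a vector `w`
witnessing degeneracy makes the Hessian matrix of `F` at `w` a multiple of `l lᵀ`, of rank at
most `1`. This is excluded as soon as the `2 × 2` minors of the Hessian matrix, which are quadratic
in `w`, span all quadratic forms in `w`. That amounts to the nonvanishing of some determinant
formed from these minors (`holdsForGeneral_isNormalized`).

* Lower bound (`IsNormalized.le_length`). A saturated ideal has a linear form that is
  a nonzerodivisor modulo it, so the Hilbert function is nondecreasing. If the length were at most
  `n + 1`, all quadrics apolar to `F` would lie in the ideal, but they have no common zero.
* Upper bound (`isSmoothable_traceProjIdeal`). The local scheme of length at most `n + 2` whose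
  ideal in the chart `s_1, …, s_n` consists of the polynomials of order at least `2` with quadratic
  part of trace `0` is apolar to `F` and is the limit for `t → 0` of the `n + 2` points `0`,
  `-t ^ 2 (1, …, 1)` and `t e_i`. The ideal of these points over `ℂ⟦t⟧` is saturated and flat, its
  generic fibre is radical, and an explicit interpolation lifts the forms of degree at least `2`
  in the limit ideal.
-/

/-! ### Homogeneous ideals of points with values in an algebra -/

section ProjIdeal

variable {R A : Type*} [CommRing R] [CommRing A] [Algebra R A] {n : ℕ}

/-- The homomorphism `g ↦ ∑_d g_d(a) X^d` attached to a point `a` with coordinates in `A`, where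
`g_d` is the homogeneous component of `g` of degree `d`. -/
noncomputable def gradedAeval (a : Fin (n + 1) → A) : CoordRing R n →ₐ[R] Polynomial A :=
  aeval fun j => Polynomial.C (a j) * Polynomial.X

theorem coeff_gradedAeval (a : Fin (n + 1) → A) (g : CoordRing R n) (d : ℕ) :
    (gradedAeval a g).coeff d = aeval a (homogeneousComponent d g) := by
  induction g using MvPolynomial.induction_on' with
  | monomial m r =>
    have h1 : gradedAeval a (monomial m r) =
        Polynomial.C (aeval a (monomial m r)) * Polynomial.X ^ m.degree := by
      rw [gradedAeval, aeval_monomial, aeval_monomial, Finsupp.prod, Finsupp.prod, map_mul,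
        map_prod, Finsupp.degree_apply, mul_assoc]
      congr 1
      rw [← Finset.prod_pow_eq_pow_sum, ← Finset.prod_mul_distrib]
      exact Finset.prod_congr rfl fun i _ => by rw [mul_pow, map_pow]
    rw [h1, Polynomial.coeff_C_mul_X_pow,
      homogeneousComponent_of_mem (isHomogeneous_monomial r rfl)]
    split_ifs <;> simp
  | add p q hp hq => simp [hp, hq]

/-- The homogeneous ideal of the scheme-theoretic image in projective space of the point
`(a_0 : … : a_n)` with values in `A`: its elements are the polynomials all of whose homogeneous
components vanish at `a`. -/
noncomputable def projIdeal (a : Fin (n + 1) → A) : Ideal (CoordRing R n) :=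
  RingHom.ker (gradedAeval (R := R) a)

theorem mem_projIdeal {a : Fin (n + 1) → A} {g : CoordRing R n} :
    g ∈ projIdeal a ↔ ∀ d, aeval a (homogeneousComponent d g) = 0 := by
  simp only [projIdeal, RingHom.mem_ker, Polynomial.ext_iff, coeff_gradedAeval,
    Polynomial.coeff_zero]

theorem mem_projIdeal_of_isHomogeneous {a : Fin (n + 1) → A} {g : CoordRing R n} {d : ℕ}
    (hg : g.IsHomogeneous d) : g ∈ projIdeal a ↔ aeval a g = 0 := by
  rw [mem_projIdeal]
  refine ⟨fun h => by simpa [homogeneousComponent_of_mem hg] using h d, fun h e => ?_⟩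
  rw [homogeneousComponent_of_mem hg]
  split_ifs <;> simp [h]

theorem isHomogeneousIdeal_projIdeal (a : Fin (n + 1) → A) :
    IsHomogeneousIdeal (projIdeal (R := R) a) := fun _ hg d =>
  (mem_projIdeal_of_isHomogeneous (homogeneousComponent_isHomogeneous d _)).2
    (mem_projIdeal.1 hg d)

theorem mem_irrelevantIdeal_of_isHomogeneous {z : CoordRing R n} (hz : z.IsHomogeneous 1) :
    z ∈ irrelevantIdeal R n := by
  have h : z ∈ Submodule.span R (Set.range (X : Fin (n + 1) → CoordRing R n)) := by
    rw [← homogeneousSubmodule_one_eq_span_X]; exact hz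
  exact Submodule.span_le_restrictScalars R _ _ h

theorem le_saturation (I : Ideal (CoordRing R n)) : I ≤ saturation I :=
  fun _ hg => ⟨0, fun p _ => I.mul_mem_left p hg⟩

theorem saturation_mono {I J : Ideal (CoordRing R n)} (h : I ≤ J) :
    saturation I ≤ saturation J := fun _ ⟨m, hm⟩ => ⟨m, fun p hp => h (hm p hp)⟩

theorem isSubschemeIdeal_projIdeal {a : Fin (n + 1) → A} {z : CoordRing R n}
    (hz : z.IsHomogeneous 1) (hza : aeval a z = 1) : IsSubschemeIdeal (projIdeal (R := R) a) := by
  refine ⟨isHomogeneousIdeal_projIdeal a, le_antisymm ?_ (le_saturation _)⟩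
  rintro g ⟨m, hm⟩
  have hX : gradedAeval a z = Polynomial.X := by
    ext d
    rw [coeff_gradedAeval, homogeneousComponent_of_mem hz, Polynomial.coeff_X]
    by_cases h : d = 1
    · rw [if_pos h, if_pos h.symm, hza]
    · rw [if_neg h, if_neg (Ne.symm h), map_zero]
  have h := hm (z ^ m) (Ideal.pow_mem_pow (mem_irrelevantIdeal_of_isHomogeneous hz) m)
  rw [projIdeal, RingHom.mem_ker, map_mul, map_pow, hX] at h
  rw [projIdeal, RingHom.mem_ker]
  ext d
  simpa [Polynomial.coeff_X_pow_mul] using congrArg (fun p => p.coeff (d + m)) h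

end ProjIdeal

/-! ### Hilbert functions -/

section Hilbert

variable {k A : Type*} [Field k] [CommRing A] [Algebra k A] {n : ℕ}

theorem hilbertFunction_projIdeal (a : Fin (n + 1) → A) (d : ℕ) :
    hilbertFunction (projIdeal (R := k) a) d = Module.finrank k
      ((homogeneousSubmodule (Fin (n + 1)) k d).map (aeval (R := k) a).toLinearMap) := by
  set φ : homogeneousSubmodule (Fin (n + 1)) k d →ₗ[k] A :=
    (aeval (R := k) a).toLinearMap.domRestrict _ with hφ
  have hker : ((projIdeal (R := k) a).restrictScalars k).submoduleOf
      (homogeneousSubmodule (Fin (n + 1)) k d) = LinearMap.ker φ := by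
    ext ⟨g, hg⟩
    rw [Submodule.submoduleOf, Submodule.mem_comap, Submodule.restrictScalars_mem]
    exact mem_projIdeal_of_isHomogeneous hg
  rw [hilbertFunction, hker, (LinearMap.quotKerEquivRange φ).finrank_eq, hφ,
    LinearMap.range_domRestrict]

/-- In large degrees every element of `A` is the value of a homogeneous polynomial, because the
values in degree `d` are also values in degree `d + 1`, by multiplication with `z`. -/
theorem isZeroDimOfLength_projIdeal [Nontrivial A] [FiniteDimensional k A] {a : Fin (n + 1) → A}
    {z : CoordRing k n} (hz : z.IsHomogeneous 1) (hza : aeval a z = 1)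
    (hsurj : Function.Surjective (aeval (R := k) a)) :
    IsZeroDimOfLength (projIdeal (R := k) a) (Module.finrank k A) := by
  refine ⟨isSubschemeIdeal_projIdeal hz hza, Module.finrank_pos, ?_⟩
  choose g hg using fun i => hsurj (Module.finBasis k A i)
  refine ⟨Finset.univ.sup fun i => (g i).totalDegree, fun d hd => ?_⟩
  have htop : (homogeneousSubmodule (Fin (n + 1)) k d).map (aeval (R := k) a).toLinearMap = ⊤ := by
    rw [eq_top_iff, ← (Module.finBasis k A).span_eq, Submodule.span_le]
    rintro _ ⟨i, rfl⟩
    have hi : (g i).totalDegree ≤ d :=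
      (Finset.le_sup (f := fun i => (g i).totalDegree) (Finset.mem_univ i)).trans hd
    refine ⟨∑ e ∈ Finset.range ((g i).totalDegree + 1),
      z ^ (d - e) * homogeneousComponent e (g i), ?_, ?_⟩
    · refine Submodule.sum_mem _ fun e he => ?_
      have h := (hz.pow (d - e)).mul (homogeneousComponent_isHomogeneous e (g i))
      rwa [one_mul, Nat.sub_add_cancel (by grind)] at h
    · rw [← hg i]
      conv_rhs => rw [← sum_homogeneousComponent (g i)]
      simp [hza]
  rw [hilbertFunction_projIdeal, htop, finrank_top]

end Hilbert

/-! ### The apolarity pairing -/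

section Differentiation

variable {n : ℕ}

theorem pderiv_pderiv_comm (i j : Fin (n + 1)) (F : MvPolynomial (Fin (n + 1)) ℂ) :
    pderiv i (pderiv j F) = pderiv j (pderiv i F) := by
  ext m
  rcases eq_or_ne i j with rfl | h
  · rfl
  · simp only [coeff_pderiv, Finsupp.add_apply, Finsupp.single_eq_of_ne h,
      Finsupp.single_eq_of_ne h.symm,
      add_right_comm m (Finsupp.single j 1) (Finsupp.single i 1)]
    ring_nf

/-- The linear operator `∂/∂x_i`. -/
noncomputable def pderivEnd (i : Fin (n + 1)) : Module.End ℂ (MvPolynomial (Fin (n + 1)) ℂ) :=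
  (pderiv i : Derivation ℂ (MvPolynomial (Fin (n + 1)) ℂ) (MvPolynomial (Fin (n + 1)) ℂ)).toLinearMap

open scoped IsMulCommutative in
theorem exists_diffAction_algHom : ∃ D : CoordRing ℂ n →ₐ[ℂ]
    Module.End ℂ (MvPolynomial (Fin (n + 1)) ℂ),
    (∀ i, D (X i) = pderivEnd i) ∧ ∀ g F, diffAction g F = D g F := by
  have hcomm : ∀ a ∈ Set.range (pderivEnd (n := n)), ∀ b ∈ Set.range (pderivEnd (n := n)),
      a * b = b * a := by
    rintro _ ⟨i, rfl⟩ _ ⟨j, rfl⟩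
    exact LinearMap.ext fun F => pderiv_pderiv_comm i j F
  have := Algebra.isMulCommutative_adjoin ℂ hcomm
  set B := Algebra.adjoin ℂ (Set.range (pderivEnd (n := n)))
  let d : Fin (n + 1) → B := fun i => ⟨pderivEnd i, Algebra.subset_adjoin ⟨i, rfl⟩⟩
  refine ⟨B.val.comp (aeval d), fun i => by simp [d], fun g F => ?_⟩
  have hm : ∀ m : Fin (n + 1) →₀ ℕ, monomialDerivative m = B.val (aeval d (monomial m (1 : ℂ))) := by
    intro m
    rw [aeval_monomial, map_one, one_mul, Finsupp.prod_fintype _ _ (by simp), ← List.prod_ofFn,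
      map_list_prod, List.map_ofFn]
    rfl
  conv_rhs => rw [g.as_sum]
  rw [map_sum, LinearMap.sum_apply, diffAction]
  refine Finset.sum_congr rfl fun m _ => ?_
  rw [hm, AlgHom.comp_apply, ← mul_one (coeff m g), ← smul_eq_mul, ← smul_monomial, map_smul,
    map_smul, smul_eq_mul, mul_one, LinearMap.smul_apply]

/-- The algebra homomorphism from `ℂ[y_0, …, y_n]` to differential operators which sends `y_i` to
`∂/∂x_i`. -/
noncomputable def diffHom : CoordRing ℂ n →ₐ[ℂ] Module.End ℂ (MvPolynomial (Fin (n + 1)) ℂ) :=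
  exists_diffAction_algHom.choose

theorem diffAction_eq (g : CoordRing ℂ n) (F : MvPolynomial (Fin (n + 1)) ℂ) :
    diffAction g F = diffHom g F := exists_diffAction_algHom.choose_spec.2 g F

theorem diffHom_X_apply (i : Fin (n + 1)) (F : MvPolynomial (Fin (n + 1)) ℂ) :
    diffHom (X i) F = pderiv i F := by
  rw [diffHom, exists_diffAction_algHom.choose_spec.1 i]; rfl

theorem diffHom_mul_apply (g h : CoordRing ℂ n) (F : MvPolynomial (Fin (n + 1)) ℂ) :
    diffHom (g * h) F = diffHom g (diffHom h F) := by
  rw [map_mul, Module.End.mul_apply]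

/-- The apolarity functional `g ↦ g(F)(0)` of a polynomial `F`. On forms `g` of the same degree
as `F` it is the apolarity pairing. -/
noncomputable def apolarFunctional (F : MvPolynomial (Fin (n + 1)) ℂ) : CoordRing ℂ n →ₗ[ℂ] ℂ where
  toFun g := constantCoeff (diffHom g F)
  map_add' g h := by simp
  map_smul' c g := by simp [constantCoeff_eq]

theorem apolarFunctional_apply (F : MvPolynomial (Fin (n + 1)) ℂ) (g : CoordRing ℂ n) :
    apolarFunctional F g = constantCoeff (diffHom g F) := rfl

theorem apolarFunctional_mul_X (F : MvPolynomial (Fin (n + 1)) ℂ) (g : CoordRing ℂ n)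
    (i : Fin (n + 1)) : apolarFunctional F (g * X i) = apolarFunctional (pderiv i F) g := by
  simp only [apolarFunctional_apply, diffHom_mul_apply, diffHom_X_apply]

theorem apolarFunctional_monomial (m : Fin (n + 1) →₀ ℕ) (F : MvPolynomial (Fin (n + 1)) ℂ) :
    apolarFunctional F (monomial m 1) = (∏ i, ((m i).factorial : ℂ)) * coeff m F := by
  induction hd : m.degree generalizing m F with
  | zero =>
    obtain rfl : m = 0 := (Finsupp.degree_eq_zero_iff m).1 hd
    have h : diffHom (monomial (0 : Fin (n + 1) →₀ ℕ) (1 : ℂ)) F = F := by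
      rw [show monomial (0 : Fin (n + 1) →₀ ℕ) (1 : ℂ) = 1 from rfl, map_one, Module.End.one_apply]
    rw [apolarFunctional_apply, h]
    simp [constantCoeff_eq]
  | succ d ih =>
    obtain ⟨i, hi⟩ : ∃ i, m i ≠ 0 := by
      by_contra! h
      have : m = 0 := Finsupp.ext h
      simp [this] at hd
    obtain ⟨m', rfl⟩ : ∃ m', m = m' + Finsupp.single i 1 :=
      ⟨m - Finsupp.single i 1, (tsub_add_cancel_of_le (by simpa [Nat.one_le_iff_ne_zero])).symm⟩
    have hd' : m'.degree = d := by simpa using hd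
    have hmul : monomial (m' + Finsupp.single i 1) (1 : ℂ) = monomial m' 1 * X i := by
      rw [X, monomial_mul, one_mul]
    rw [hmul, apolarFunctional_mul_X, ih m' _ hd', coeff_pderiv,
      ← Finset.mul_prod_erase _ _ (Finset.mem_univ i),
      ← Finset.mul_prod_erase _ (fun j => (((m' + Finsupp.single i 1 : Fin (n + 1) →₀ ℕ) j).factorial : ℂ))
        (Finset.mem_univ i)]
    have hprod : ∏ j ∈ Finset.univ.erase i, (((m' + Finsupp.single i 1 : Fin (n + 1) →₀ ℕ) j).factorial : ℂ) =
        ∏ j ∈ Finset.univ.erase i, ((m' j).factorial : ℂ) :=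
      Finset.prod_congr rfl fun j hj => by
        simp [Finsupp.single_eq_of_ne (Finset.ne_of_mem_erase hj)]
    rw [hprod, Finsupp.add_apply, Finsupp.single_eq_same, Nat.factorial_succ]
    push_cast
    ring_nf

theorem monomial_eq_smul_one {σ : Type*} (m : σ →₀ ℕ) (c : ℂ) :
    monomial m c = c • monomial m (1 : ℂ) := by
  rw [smul_monomial, smul_eq_mul, mul_one]

theorem apolarFunctional_homogeneousComponent {F : MvPolynomial (Fin (n + 1)) ℂ} {d : ℕ}
    (hF : F.IsHomogeneous d) (g : CoordRing ℂ n) :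
    apolarFunctional F (homogeneousComponent d g) = apolarFunctional F g := by
  induction g using MvPolynomial.induction_on' with
  | monomial m r =>
    rw [homogeneousComponent_of_mem (isHomogeneous_monomial r rfl)]
    split_ifs with h
    · rfl
    · rw [monomial_eq_smul_one, map_smul, apolarFunctional_monomial,
        hF.coeff_eq_zero (Ne.symm h)]
      simp
  | add p q hp hq => simp [hp, hq]

/-- Apolarity can be tested on constant terms, because `I` is stable under multiplication: the
constant terms of all `h(g(F))` determine `g(F)`. -/
theorem isApolar_iff {I : Ideal (CoordRing ℂ n)} {F : MvPolynomial (Fin (n + 1)) ℂ} :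
    IsApolar I F ↔ ∀ g ∈ I, apolarFunctional F g = 0 := by
  refine ⟨fun h g hg => ?_, fun h g hg => ?_⟩
  · rw [apolarFunctional_apply, ← diffAction_eq, h g hg, map_zero]
  · rw [diffAction_eq]
    ext m
    have h1 := h (monomial m 1 * g) (I.mul_mem_left _ hg)
    rw [apolarFunctional_apply, diffHom_mul_apply, ← apolarFunctional_apply,
      apolarFunctional_monomial] at h1
    rw [coeff_zero]
    refine (mul_eq_zero.1 h1).resolve_left (Finset.prod_ne_zero_iff.2 fun i _ => ?_)
    exact_mod_cast (m i).factorial_ne_zero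

/-- A point with values in an algebra `A` is apolar to `F` as soon as, on forms of the degree of
`F`, the apolarity functional factors through evaluation at that point. -/
theorem isApolar_projIdeal {A : Type*} [CommRing A] [Algebra ℂ A] {a : Fin (n + 1) → A}
    {F : MvPolynomial (Fin (n + 1)) ℂ} {d : ℕ} (hF : F.IsHomogeneous d)
    (h : ∀ g : CoordRing ℂ n, g.IsHomogeneous d → aeval a g = 0 → apolarFunctional F g = 0) :
    IsApolar (projIdeal a) F := isApolar_iff.2 fun g hg => by
  rw [← apolarFunctional_homogeneousComponent hF]
  exact h _ (homogeneousComponent_isHomogeneous d g) (mem_projIdeal.1 hg d)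

end Differentiation

/-! ### The local Gorenstein scheme of a cubic form -/

section LocalGorenstein

/-- The largest ideal contained in the kernel of a linear functional `ψ` on an algebra. -/
def kernelIdeal {k B : Type*} [CommRing k] [CommRing B] [Algebra k B] (ψ : B →ₗ[k] k) : Ideal B where
  carrier := {f | ∀ h, ψ (f * h) = 0}
  zero_mem' := fun h => by simp
  add_mem' := fun ha hb h => by rw [add_mul, map_add, ha h, hb h, add_zero]
  smul_mem' := fun c a ha h => by rw [smul_eq_mul, mul_comm c, mul_assoc]; exact ha _

theorem finrank_quotient_le {k B V : Type*} [Field k] [CommRing B] [Algebra k B] [AddCommGroup V]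
    [Module k V] [FiniteDimensional k V] {I : Ideal B} (L : B →ₗ[k] V)
    (hL : ∀ f, L f = 0 → f ∈ I) :
    FiniteDimensional k (B ⧸ I) ∧ Module.finrank k (B ⧸ I) ≤ Module.finrank k V := by
  have e := L.quotKerEquivRange
  have : FiniteDimensional k (B ⧸ LinearMap.ker L) := LinearEquiv.finiteDimensional e.symm
  let p : (B ⧸ LinearMap.ker L) →ₗ[k] (B ⧸ I) :=
    (LinearMap.ker L).liftQ (Ideal.Quotient.mkₐ k I).toLinearMap
      fun f hf => Ideal.Quotient.eq_zero_iff_mem.2 (hL f hf)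
  have hp : Function.Surjective p := fun x => by
    obtain ⟨f, rfl⟩ := Ideal.Quotient.mk_surjective x
    exact ⟨Submodule.Quotient.mk f, rfl⟩
  refine ⟨Module.Finite.of_surjective p hp, (LinearMap.finrank_le_finrank_of_surjective hp).trans ?_⟩
  rw [e.finrank_eq]
  exact Submodule.finrank_le _

variable {n : ℕ}

/-- The functional on `ℂ[s_1, …, s_n]` given by the dehomogenization of a cubic form `F` with
respect to `x_0`: a monomial of degree at most `3` is homogenized by `y_0` and paired with `F`. -/
noncomputable def dehomFunctional (F : MvPolynomial (Fin (n + 1)) ℂ) :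
    MvPolynomial (Fin n) ℂ →ₗ[ℂ] ℂ :=
  (basisMonomials (Fin n) ℂ).constr ℂ fun m =>
    if m.degree ≤ 3 then apolarFunctional F (monomial (m.cons (3 - m.degree)) 1) else 0

theorem dehomFunctional_monomial (F : MvPolynomial (Fin (n + 1)) ℂ) (m : Fin n →₀ ℕ) (c : ℂ) :
    dehomFunctional F (monomial m c) =
      c * if m.degree ≤ 3 then apolarFunctional F (monomial (m.cons (3 - m.degree)) 1) else 0 := by
  rw [monomial_eq_smul_one, map_smul, smul_eq_mul]
  congr 1
  exact Module.Basis.constr_basis (basisMonomials (Fin n) ℂ) ℂ _ m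

theorem dehomFunctional_eq_zero {F : MvPolynomial (Fin (n + 1)) ℂ} {f : MvPolynomial (Fin n) ℂ}
    (h : ∀ m : Fin n →₀ ℕ, m.degree ≤ 3 → coeff m f = 0) : dehomFunctional F f = 0 := by
  rw [f.as_sum, map_sum]
  refine Finset.sum_eq_zero fun m _ => ?_
  rw [dehomFunctional_monomial]
  split_ifs with hm
  · rw [h m hm, zero_mul]
  · rw [mul_zero]

theorem coeff_mul_eq_zero_of_degree {σ : Type*} {f : MvPolynomial σ ℂ} {a : ℕ}
    (h : ∀ m : σ →₀ ℕ, m.degree ≤ a → coeff m f = 0) (c : ℂ) {m' m : σ →₀ ℕ}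
    (hm : m.degree ≤ a + m'.degree) : coeff m (f * monomial m' c) = 0 := by
  classical
  rw [coeff_mul_monomial']
  split_ifs with hle
  · obtain ⟨u, rfl⟩ := exists_add_of_le hle
    rw [add_tsub_cancel_left, h u (by rw [map_add] at hm; omega), zero_mul]
  · rfl

theorem degree_eq_one {σ : Type*} {m : σ →₀ ℕ} (h : m.degree = 1) : ∃ i, m = Finsupp.single i 1 := by
  obtain ⟨i, hi⟩ : ∃ i, m i ≠ 0 := by
    by_contra! h0
    have : m = 0 := Finsupp.ext h0
    simp [this] at h
  obtain ⟨u, hu⟩ := exists_add_of_le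
    (show Finsupp.single i 1 ≤ m by simpa [Nat.one_le_iff_ne_zero])
  refine ⟨i, ?_⟩
  have h0 : u.degree = 0 := by rw [hu, map_add, Finsupp.degree_single] at h; omega
  rw [hu, (Finsupp.degree_eq_zero_iff u).1 h0, add_zero]

/-- Polynomials `f`, `h` without terms of degree at most `1` satisfy `ψ(f h) = 0`, so that the
symmetric form `ψ(f h)` vanishes on a subspace of codimension `n + 1` and has rank at most
`2 (n + 1)`. -/
theorem finrank_quotient_dehomFunctional_le (F : MvPolynomial (Fin (n + 1)) ℂ) :
    FiniteDimensional ℂ (MvPolynomial (Fin n) ℂ ⧸ kernelIdeal (dehomFunctional F)) ∧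
    Module.finrank ℂ (MvPolynomial (Fin n) ℂ ⧸ kernelIdeal (dehomFunctional F)) ≤ 2 * n + 2 := by
  let ψ := dehomFunctional F
  -- the terms of `f` of degree at most `1`, and the pairings of `f` with `1, s_1, …, s_n`
  let L : MvPolynomial (Fin n) ℂ →ₗ[ℂ] (ℂ × (Fin n → ℂ)) × (ℂ × (Fin n → ℂ)) :=
    ((lcoeff ℂ 0).prod (LinearMap.pi fun i => lcoeff ℂ (Finsupp.single i 1))).prod
      (ψ.prod (LinearMap.pi fun i => ψ ∘ₗ LinearMap.mulRight ℂ (X i)))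
  have hL : ∀ f, L f = 0 → f ∈ kernelIdeal (dehomFunctional F) := by
    intro f hf
    simp only [L, LinearMap.prod_apply, Function.prod_apply, Prod.mk_eq_zero, funext_iff,
      LinearMap.pi_apply, LinearMap.comp_apply, LinearMap.mulRight_apply, Pi.zero_apply,
      lcoeff_apply] at hf
    obtain ⟨⟨h0, h1⟩, h2, h3⟩ := hf
    have hlow : ∀ m : Fin n →₀ ℕ, m.degree ≤ 1 → coeff m f = 0 := by
      intro m hm
      rcases Nat.le_one_iff_eq_zero_or_eq_one.1 hm with h | h
      · rw [(Finsupp.degree_eq_zero_iff m).1 h, h0]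
      · obtain ⟨i, rfl⟩ := degree_eq_one h
        exact h1 i
    intro h
    induction h using MvPolynomial.induction_on' with
    | add p q hp hq => rw [mul_add, map_add, hp, hq, add_zero]
    | monomial m c =>
      by_cases hm : 2 ≤ m.degree
      · exact dehomFunctional_eq_zero fun m' hm' =>
          coeff_mul_eq_zero_of_degree hlow c (by omega)
      · rw [monomial_eq_smul_one, mul_smul_comm, map_smul]
        rcases Nat.le_one_iff_eq_zero_or_eq_one.1 (show m.degree ≤ 1 by omega) with h | h
        · rw [(Finsupp.degree_eq_zero_iff m).1 h,
            show monomial (0 : Fin n →₀ ℕ) (1 : ℂ) = 1 from rfl, mul_one]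
          exact smul_eq_zero_of_right _ h2
        · obtain ⟨i, rfl⟩ := degree_eq_one h
          exact smul_eq_zero_of_right _ (h3 i)
  obtain ⟨hfin, hle⟩ := finrank_quotient_le L hL
  refine ⟨hfin, hle.trans (le_of_eq ?_)⟩
  simp [Module.finrank_prod]
  ring

theorem cons_degree_tail {m : Fin (n + 1) →₀ ℕ} (hm : m.degree = 3) :
    m.tail.degree ≤ 3 ∧ m.tail.cons (3 - m.tail.degree) = m := by
  have h : m 0 + m.tail.degree = 3 := by
    rw [← hm, Finsupp.degree_eq_sum, Finsupp.degree_eq_sum, Fin.sum_univ_succ]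
    rfl
  refine ⟨by omega, ?_⟩
  rw [show 3 - m.tail.degree = m 0 by omega, Finsupp.cons_tail]

theorem aeval_cons_one_X_monomial (m : Fin (n + 1) →₀ ℕ) :
    aeval (R := ℂ) (Fin.cons 1 X : Fin (n + 1) → MvPolynomial (Fin n) ℂ) (monomial m 1) =
      monomial m.tail 1 := by
  rw [aeval_monomial, map_one, one_mul, Finsupp.prod_fintype _ _ (by simp), Fin.prod_univ_succ,
    monomial_eq, Finsupp.prod_fintype _ _ (by simp)]
  simp [Finsupp.tail_apply]

theorem cactusRank_le_of_coeff_ne_zero {F : MvPolynomial (Fin (n + 1)) ℂ} (hF : F.IsHomogeneous 3)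
    (h0 : coeff (Finsupp.single 0 3) F ≠ 0) : cactusRank F ≤ 2 * (n : ℕ∞) + 2 := by
  obtain ⟨hfin, hle⟩ := finrank_quotient_dehomFunctional_le F
  set I := kernelIdeal (dehomFunctional F) with hI
  let a : Fin (n + 1) → MvPolynomial (Fin n) ℂ ⧸ I := fun j =>
    Ideal.Quotient.mkₐ ℂ I ((Fin.cons 1 X : Fin (n + 1) → MvPolynomial (Fin n) ℂ) j)
  have ha : aeval (R := ℂ) a = (Ideal.Quotient.mkₐ ℂ I).comp (aeval (Fin.cons 1 X)) := by
    ext j; simp [a]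
  have hψ : ∀ g : CoordRing ℂ n, g.IsHomogeneous 3 →
      dehomFunctional F (aeval (Fin.cons 1 X) g) = apolarFunctional F g := by
    intro g hg
    rw [g.as_sum, map_sum, map_sum, map_sum]
    refine Finset.sum_congr rfl fun m hm => ?_
    have hd : m.degree = 3 := by
      by_contra h
      exact mem_support_iff.1 hm (hg.coeff_eq_zero h)
    rw [monomial_eq_smul_one]
    simp only [map_smul]
    rw [aeval_cons_one_X_monomial, dehomFunctional_monomial, if_pos (cons_degree_tail hd).1,
      (cons_degree_tail hd).2, one_mul]
  have hne : Nontrivial (MvPolynomial (Fin n) ℂ ⧸ I) := by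
    refine Ideal.Quotient.nontrivial_iff.2 fun htop => ?_
    have h1 : (1 : MvPolynomial (Fin n) ℂ) ∈ I := htop ▸ Submodule.mem_top
    have h2 := h1 1
    rw [mul_one, ← C_1, C_apply, dehomFunctional_monomial] at h2
    have h3 : (0 : Fin n →₀ ℕ).cons 3 = Finsupp.single 0 3 := by
      ext j; refine Fin.cases ?_ (fun j => ?_) j <;> simp
    simp only [map_zero, Nat.zero_le, if_true, Nat.sub_zero, h3, one_mul] at h2
    rw [apolarFunctional_monomial] at h2
    refine h0 ((mul_eq_zero.1 h2).resolve_left (Finset.prod_ne_zero_iff.2 fun i _ => ?_))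
    exact_mod_cast Nat.factorial_ne_zero _
  have hsurj : Function.Surjective (aeval (R := ℂ) a) := by
    rw [ha]
    refine (Ideal.Quotient.mkₐ_surjective ℂ I).comp fun f => ?_
    refine ⟨rename Fin.succ f, ?_⟩
    change aeval (Fin.cons 1 X : Fin (n + 1) → MvPolynomial (Fin n) ℂ) (rename Fin.succ f) = f
    rw [aeval_rename]
    simp [Function.comp_def]
  have hz := isZeroDimOfLength_projIdeal (isHomogeneous_X ℂ (0 : Fin (n + 1)))
    (by rw [ha]; simp) hsurj
  refine (iInf₂_le _ ⟨projIdeal a, hz, isApolar_projIdeal hF fun g hg hga => ?_⟩).trans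
    (by exact_mod_cast hle)
  rw [ha, AlgHom.comp_apply, Ideal.Quotient.mkₐ_eq_mk, Ideal.Quotient.eq_zero_iff_mem] at hga
  rw [← hψ g hg, ← mul_one (aeval _ g)]
  exact hga 1

end LocalGorenstein

/-! ### Factors of forms -/

section HomogeneousFactors

variable {n : ℕ} {R : Type*} [CommRing R]

theorem aeval_X_apply (g : CoordRing R n) :
    aeval (R := R) (X : Fin (n + 1) → CoordRing R n) g = g := by
  rw [aeval_X_left, AlgHom.id_apply]

theorem gradedAeval_X_of_isHomogeneous {g : CoordRing R n} {d : ℕ} (hg : g.IsHomogeneous d) :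
    gradedAeval X g = Polynomial.monomial d g := by
  ext1 e
  rw [coeff_gradedAeval, homogeneousComponent_of_mem hg, Polynomial.coeff_monomial]
  by_cases h : e = d
  · rw [if_pos h, if_pos h.symm, aeval_X_apply]
  · rw [if_neg h, if_neg (Ne.symm h), map_zero]

/-- Factors of a nonzero form are forms: the polynomial `∑_d g_d X^d` in an auxiliary variable
is multiplicative in `g`, and a factor of a monomial is a monomial. -/
theorem isHomogeneous_left_of_mul [IsDomain R] {f g : CoordRing R n} {d : ℕ}
    (h : (f * g).IsHomogeneous d) (h0 : f * g ≠ 0) : ∃ e, f.IsHomogeneous e := by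
  set φ : CoordRing R n →ₐ[R] Polynomial (CoordRing R n) := gradedAeval X with hφ
  have hmul : φ f * φ g = Polynomial.monomial d (f * g) := by
    rw [← map_mul]; exact gradedAeval_X_of_isHomogeneous h
  have hne : φ f * φ g ≠ 0 := by
    rw [hmul]; exact (Polynomial.monomial_eq_zero_iff _ _).not.2 h0
  have hf := left_ne_zero_of_mul hne
  have hg := right_ne_zero_of_mul hne
  have h1 : (φ f).natDegree + (φ g).natDegree = d := by
    rw [← Polynomial.natDegree_mul hf hg, hmul, Polynomial.natDegree_monomial_eq _ h0]
  have h2 : (φ f).natTrailingDegree + (φ g).natTrailingDegree = d := by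
    rw [← Polynomial.natTrailingDegree_mul hf hg, hmul, Polynomial.natTrailingDegree_monomial h0]
  have h3 := (φ f).natTrailingDegree_le_natDegree
  have h4 := (φ g).natTrailingDegree_le_natDegree
  refine ⟨(φ f).natDegree, ?_⟩
  have hcomp : ∀ e, e ≠ (φ f).natDegree → homogeneousComponent e f = 0 := by
    intro e he
    rw [← aeval_X_apply (homogeneousComponent e f), ← coeff_gradedAeval, ← hφ]
    rcases lt_or_gt_of_ne he with hlt | hlt
    · exact Polynomial.coeff_eq_zero_of_lt_natTrailingDegree (by omega)
    · exact Polynomial.coeff_eq_zero_of_natDegree_lt hlt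
  generalize (φ f).natDegree = N at hcomp
  rw [← sum_homogeneousComponent f]
  refine IsHomogeneous.sum _ _ _ fun e _ => ?_
  rcases eq_or_ne e N with he | he
  · rw [← he]; exact homogeneousComponent_isHomogeneous e f
  · rw [hcomp e he]; exact isHomogeneous_zero _ _ _

theorem exists_linear_mul_quadratic {F : MvPolynomial (Fin (n + 1)) ℂ}
    (hF : F ∈ reducibleCubicForms n) :
    ∃ f q : MvPolynomial (Fin (n + 1)) ℂ, f.IsHomogeneous 1 ∧ q.IsHomogeneous 2 ∧ F = f * q := by
  obtain ⟨h3, h0, hirr⟩ := hF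
  have hunit : ¬ IsUnit F := fun h => by
    have hd := h3.totalDegree h0
    rw [MvPolynomial.isUnit_iff_totalDegree_of_isReduced] at h
    omega
  have hnon : ∀ {g : MvPolynomial (Fin (n + 1)) ℂ}, g.IsHomogeneous 0 → g ≠ 0 → IsUnit g := by
    intro g hg hg0
    rw [← totalDegree_zero_iff_isHomogeneous, totalDegree_eq_zero_iff_eq_C] at hg
    rw [hg]
    refine IsUnit.map _ (isUnit_iff_ne_zero.2 fun h => hg0 ?_)
    rw [hg, h, C_0]
  obtain ⟨f, g, hfg, hf, hg⟩ : ∃ f g, F = f * g ∧ ¬ IsUnit f ∧ ¬ IsUnit g := by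
    by_contra! hcon
    exact hirr ⟨hunit, fun a b hab => or_iff_not_imp_left.2 fun ha => hcon a b hab ha⟩
  have h0' : f * g ≠ 0 := hfg ▸ h0
  obtain ⟨a, ha⟩ := isHomogeneous_left_of_mul (hfg ▸ h3) h0'
  obtain ⟨b, hb⟩ := isHomogeneous_left_of_mul (f := g) (g := f) (by rw [mul_comm]; exact hfg ▸ h3)
    (by rwa [mul_comm])
  have hab : a + b = 3 := (ha.mul hb).inj_right (hfg ▸ h3) h0'
  have ha0 : a ≠ 0 := fun h => hf (hnon (h ▸ ha) (left_ne_zero_of_mul h0'))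
  have hb0 : b ≠ 0 := fun h => hg (hnon (h ▸ hb) (right_ne_zero_of_mul h0'))
  rcases (show (a = 1 ∧ b = 2) ∨ (a = 2 ∧ b = 1) by omega) with ⟨rfl, rfl⟩ | ⟨rfl, rfl⟩
  · exact ⟨f, g, ha, hb, hfg⟩
  · exact ⟨g, f, hb, ha, by rw [hfg, mul_comm]⟩

end HomogeneousFactors

/-! ### The tensor of a product of a linear and a quadratic form -/

section Tensor

variable {n : ℕ}

/-- The symmetric tensor `l_i A_jk + l_j A_ik + l_k A_ij` of the product of a linear form and
a quadratic form with coefficient vector `l` and symmetric matrix `A`. -/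
def productTensor {ι : Type*} (l : ι → ℂ) (A : ι → ι → ℂ) (i j k : ι) : ℂ :=
  l i * A j k + l j * A i k + l k * A i j

theorem eq_C_of_isHomogeneous_zero {g : MvPolynomial (Fin (n + 1)) ℂ} (hg : g.IsHomogeneous 0) :
    g = C (constantCoeff g) := by
  rw [← totalDegree_zero_iff_isHomogeneous] at hg
  exact totalDegree_eq_zero_iff_eq_C.1 hg

theorem apolarFunctional_mul_of_isHomogeneous {f q : MvPolynomial (Fin (n + 1)) ℂ}
    (hf : f.IsHomogeneous 1) (hq : q.IsHomogeneous 2) (i j k : Fin (n + 1)) :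
    apolarFunctional (f * q) (X i * X j * X k) =
      productTensor (fun i => constantCoeff (pderiv i f))
        (fun i j => constantCoeff (pderiv i (pderiv j q))) i j k := by
  have h1 : ∀ i, pderiv i f = C (constantCoeff (pderiv i f)) := fun i =>
    eq_C_of_isHomogeneous_zero hf.pderiv
  have h2 : ∀ i j, pderiv i (pderiv j q) = C (constantCoeff (pderiv i (pderiv j q))) := fun i j =>
    eq_C_of_isHomogeneous_zero hq.pderiv.pderiv
  have h3 : ∀ i j, pderiv i (pderiv j f) = 0 := fun i j => by rw [h1 j, pderiv_C]
  have h4 : ∀ i j k, pderiv k (pderiv i (pderiv j q)) = 0 := fun i j k => by rw [h2 i j, pderiv_C]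
  rw [apolarFunctional_mul_X, apolarFunctional_mul_X, ← one_mul (X i), apolarFunctional_mul_X,
    apolarFunctional_apply, map_one, Module.End.one_apply]
  simp only [pderiv_mul, map_add, h3, h4, zero_mul, mul_zero, zero_add, add_zero]
  rw [productTensor]
  simp only [map_mul]
  rw [pderiv_pderiv_comm i k]
  ring

theorem constantCoeff_pderiv_comm (q : MvPolynomial (Fin (n + 1)) ℂ) (i j : Fin (n + 1)) :
    constantCoeff (pderiv i (pderiv j q)) = constantCoeff (pderiv j (pderiv i q)) := by
  rw [pderiv_pderiv_comm]

end Tensor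

/-! ### Simultaneous normal form of a linear and a quadratic form -/

section NormalForm

variable {n : ℕ}

/-- If a linear form `l` on `ℂ^(n+1)` and a symmetric matrix `A` are such that `A` is
nondegenerate on the kernel of `l`, then some basis `V` of `ℂ^(n+1)` turns `l` into the first
coordinate and `A` into a diagonal matrix with entries `c, 1, …, 1`. -/
theorem exists_basis_diagonal {l : Fin (n + 1) → ℂ} (hl : l ≠ 0)
    {A : Matrix (Fin (n + 1)) (Fin (n + 1)) ℂ} (hA : A.IsSymm)
    (hnd : ∀ w : Fin (n + 1) → ℂ, l ⬝ᵥ w = 0 → (∃ α : ℂ, A.mulVec w = α • l) → w = 0) :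
    ∃ (V W : Matrix (Fin (n + 1)) (Fin (n + 1)) ℂ) (c : ℂ), V * W = 1 ∧ W * V = 1 ∧
      (∀ a, V a ⬝ᵥ l = if a = 0 then 1 else 0) ∧
      ∀ a b, V a ⬝ᵥ A.mulVec (V b) = if a = b then (if a = 0 then c else 1) else 0 := by
  let f : (Fin (n + 1) → ℂ) →ₗ[ℂ] ℂ := 
    { toFun := fun w => l ⬝ᵥ w
      map_add' := dotProduct_add l
      map_smul' := fun c w => dotProduct_smul c l w }
  have hf : ∀ w, f w = l ⬝ᵥ w := fun _ => rfl
  obtain ⟨j, hj⟩ := Function.ne_iff.1 hl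
  -- a vector on which `l` takes the value `1`
  obtain ⟨p, hp⟩ : ∃ p : Fin (n + 1) → ℂ, l ⬝ᵥ p = 1 :=
    ⟨Pi.single j (l j)⁻¹, by rw [dotProduct_single]; exact mul_inv_cancel₀ hj⟩
  have hf0 : f ≠ 0 := fun h => by
    have := hf p
    rw [h, hp] at this
    simp at this
  have hrank : Module.finrank ℂ (LinearMap.ker f) = n := by
    have := Module.Dual.finrank_ker_add_one_of_ne_zero hf0
    simpa using this
  let B : LinearMap.BilinForm ℂ (Fin (n + 1) → ℂ) := Matrix.toBilin' A
  have hB : ∀ x y, B x y = x ⬝ᵥ A.mulVec y := fun x y => Matrix.toBilin'_apply' A x y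
  have hsymm : ∀ x y, x ⬝ᵥ A.mulVec y = y ⬝ᵥ A.mulVec x := fun x y => by
    rw [Matrix.dotProduct_mulVec, ← Matrix.mulVec_transpose, hA.eq, dotProduct_comm]
  obtain ⟨v, hv⟩ := LinearMap.BilinForm.exists_orthogonal_basis
    (B := B.restrict (LinearMap.ker f)) ⟨fun x y => by
      simp only [LinearMap.BilinForm.restrict_apply, LinearMap.domRestrict_apply, hB, RingHom.id_apply]
      exact hsymm _ _⟩
  let v' := v.reindex (finCongr hrank)
  have hu0 : ∀ i, l ⬝ᵥ (v' i : Fin (n + 1) → ℂ) = 0 := fun i => (v' i).2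
  have huo : ∀ i j, i ≠ j → (v' i : Fin (n + 1) → ℂ) ⬝ᵥ A.mulVec (v' j) = 0 := by
    intro i j hij
    have h := hv (show (finCongr hrank).symm i ≠ (finCongr hrank).symm j by simpa using hij)
    simpa [v', hB] using h
  have hune : ∀ i, (v' i : Fin (n + 1) → ℂ) ⬝ᵥ A.mulVec (v' i) ≠ 0 := by
    intro i hi
    have hker : ∀ w : LinearMap.ker f, (w : Fin (n + 1) → ℂ) ⬝ᵥ A.mulVec (v' i) = 0 := by
      intro w
      rw [← v'.sum_repr w, Submodule.coe_sum, sum_dotProduct]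
      refine Finset.sum_eq_zero fun j _ => ?_
      rw [Submodule.coe_smul, smul_dotProduct]
      rcases eq_or_ne j i with rfl | h
      · rw [hi, smul_zero]
      · rw [huo j i h, smul_zero]
    have h0 : (v' i : Fin (n + 1) → ℂ) = 0 := by
      refine hnd _ (hu0 i) ⟨p ⬝ᵥ A.mulVec (v' i), ?_⟩
      refine dotProduct_eq _ _ fun w => ?_
      have hw := hker ⟨w - (l ⬝ᵥ w) • p, by
        rw [LinearMap.mem_ker, hf, dotProduct_sub, dotProduct_smul, hp, smul_eq_mul, mul_one,
          sub_self]⟩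
      rw [sub_dotProduct, smul_dotProduct, sub_eq_zero] at hw
      rw [dotProduct_comm, hw, smul_dotProduct, smul_eq_mul, smul_eq_mul, mul_comm]
    exact v'.ne_zero i (Subtype.ext h0)
  choose s hs using fun i => IsAlgClosed.exists_pow_nat_eq
    ((v' i : Fin (n + 1) → ℂ) ⬝ᵥ A.mulVec (v' i)) two_pos
  have hs0 : ∀ i, s i ≠ 0 := fun i h => hune i (by rw [← hs i, h]; simp)
  -- an orthonormal basis of the kernel of `l`
  let e : Fin n → Fin (n + 1) → ℂ := fun i => (s i)⁻¹ • (v' i : Fin (n + 1) → ℂ)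
  have he0 : ∀ i, l ⬝ᵥ e i = 0 := fun i => by
    rw [dotProduct_smul, hu0, smul_zero]
  have heo : ∀ i j, e i ⬝ᵥ A.mulVec (e j) = if i = j then 1 else 0 := by
    intro i j
    simp only [e, Matrix.mulVec_smul, smul_dotProduct, dotProduct_smul, smul_eq_mul]
    split_ifs with h
    · subst h
      rw [← hs]
      field_simp [hs0 i]
    · rw [huo i j h]; simp
  -- `p` is made orthogonal to the kernel of `l` without changing `l(p)`
  let p' := p - ∑ i, (e i ⬝ᵥ A.mulVec p) • e i
  have hp' : l ⬝ᵥ p' = 1 := by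
    simp only [p', dotProduct_sub, dotProduct_sum, dotProduct_smul, he0, hp]
    simp
  have hpe : ∀ i, e i ⬝ᵥ A.mulVec p' = 0 := by
    intro i
    simp only [p', Matrix.mulVec_sub, Matrix.mulVec_sum, Matrix.mulVec_smul, dotProduct_sub,
      dotProduct_sum, dotProduct_smul, heo]
    simp
  let V : Matrix (Fin (n + 1)) (Fin (n + 1)) ℂ := Matrix.of (Fin.cons p' e)
  have hV0 : V 0 = p' := rfl
  have hVs : ∀ i : Fin n, V i.succ = e i := fun i => rfl
  have hVl : ∀ a, V a ⬝ᵥ l = if a = 0 then 1 else 0 := by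
    intro a
    rw [dotProduct_comm]
    refine Fin.cases ?_ (fun i => ?_) a
    · rw [hV0, hp', if_pos rfl]
    · rw [hVs, he0, if_neg (Fin.succ_ne_zero i)]
  have hVA : ∀ a b, V a ⬝ᵥ A.mulVec (V b) =
      if a = b then (if a = 0 then p' ⬝ᵥ A.mulVec p' else 1) else 0 := by
    intro a b
    refine Fin.cases ?_ (fun i => ?_) a <;> refine Fin.cases ?_ (fun j => ?_) b
    · simp [hV0]
    · rw [hV0, hVs, hsymm, hpe, if_neg (Fin.succ_ne_zero j).symm]
    · rw [hV0, hVs, hpe, if_neg (Fin.succ_ne_zero i)]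
    · rw [hVs, hVs, heo]
      simp
  -- pairing with `l` and with the rows of `V` recovers the coefficients of a combination of rows
  have hunit : IsUnit V := by
    rw [← Matrix.vecMul_injective_iff_isUnit]
    refine (injective_iff_map_eq_zero (Matrix.vecMulLinear V)).2 fun x hx => ?_
    rw [Matrix.vecMulLinear_apply, Matrix.vecMul_eq_sum] at hx
    have hl0 : x 0 = 0 := by
      have h := congrArg (fun w => w ⬝ᵥ l) hx
      simpa [sum_dotProduct, hVl] using h
    ext b
    refine Fin.cases hl0 (fun j => ?_) b
    have h := congrArg (fun w => w ⬝ᵥ A.mulVec (V j.succ)) hx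
    simpa [sum_dotProduct, hVA, Fin.succ_ne_zero] using h
  refine ⟨V, V⁻¹, p' ⬝ᵥ A.mulVec p', ?_, ?_, hVl, hVA⟩
  · exact Matrix.mul_nonsing_inv _ ((Matrix.isUnit_iff_isUnit_det _).1 hunit)
  · exact Matrix.nonsing_inv_mul _ ((Matrix.isUnit_iff_isUnit_det _).1 hunit)

end NormalForm

/-! ### General reducible cubic forms -/

section Genericity

variable {n : ℕ}

/-- The coefficient of `w_c w_d` in the minor `M_{i j} M_{k l} - M_{i l} M_{k j}` of the matrix
`M_{i j} = ∑_c T_{i j c} w_c` of linear forms in `w`; here `r = ((i, j), (k, l))`. -/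
def minorCoeff {S : Type*} [CommRing S] {ι : Type*} (T : ι → ι → ι → S)
    (r : (ι × ι) × ι × ι) (c d : ι) : S :=
  T r.1.1 r.1.2 c * T r.2.1 r.2.2 d - T r.1.1 r.2.2 c * T r.2.1 r.1.2 d

theorem sum_minorCoeff {ι : Type*} [Fintype ι] (T : ι → ι → ι → ℂ) (r : (ι × ι) × ι × ι)
    (w : ι → ℂ) : ∑ c, ∑ d, minorCoeff T r c d * (w c * w d) =
      (∑ c, T r.1.1 r.1.2 c * w c) * (∑ d, T r.2.1 r.2.2 d * w d) -
      (∑ c, T r.1.1 r.2.2 c * w c) * (∑ d, T r.2.1 r.1.2 d * w d) := by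
  simp only [minorCoeff, Finset.sum_mul_sum, ← Finset.sum_sub_distrib]
  exact Finset.sum_congr rfl fun c _ => Finset.sum_congr rfl fun d _ => by ring

/-- If the chosen minors span the quadratic forms in `w`, then the matrix `∑_c T_{i j c} w_c`
has rank at most `1` only for `w = 0`. -/
theorem eq_zero_of_minors {ι : Type*} [Fintype ι] [DecidableEq ι] {T : ι → ι → ι → ℂ}
    {r : ι × ι → (ι × ι) × ι × ι}
    (hdet : (Matrix.of fun a b : ι × ι => minorCoeff T (r a) b.1 b.2).det ≠ 0) {w u : ι → ℂ} {α : ℂ}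
    (h : ∀ i j, ∑ c, T i j c * w c = α * (u i * u j)) : w = 0 := by
  have hker : (Matrix.of fun a b : ι × ι => minorCoeff T (r a) b.1 b.2).mulVec
      (fun b => w b.1 * w b.2) = 0 := by
    ext a
    rw [Matrix.mulVec, dotProduct, Fintype.sum_prod_type]
    simp only [Matrix.of_apply, sum_minorCoeff, h, Pi.zero_apply]
    ring
  have h0 := Matrix.eq_zero_of_mulVec_eq_zero hdet hker
  ext i
  simpa using congrFun h0 (i, i)

/-- For the tensor of `x_0 (x_1 ^ 2 + ⋯ + x_n ^ 2)` every product `w_a w_b` is, up to a factor,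
one of the minors, provided that `n > 1`. -/
theorem exists_minor_eq_single (hn : 1 < n) (ab : Fin (n + 1) × Fin (n + 1)) :
    ∃ r : (Fin (n + 1) × Fin (n + 1)) × Fin (n + 1) × Fin (n + 1), ∀ c d : Fin (n + 1),
      minorCoeff (productTensor (fun i => if i = 0 then (1 : ℂ) else 0)
        fun i j => if i = j then if i = 0 then 0 else 2 else 0) r c d =
      if ab = (c, d) then 4 else 0 := by
  obtain ⟨a, b⟩ := ab
  have hex : ∀ i : Fin (n + 1), ∃ j : Fin (n + 1), j ≠ 0 ∧ j ≠ i := by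
    intro i
    by_contra! h
    have h1 := h ⟨1, by omega⟩ (by simp [Fin.ext_iff])
    have h2 := h ⟨2, by omega⟩ (by simp [Fin.ext_iff])
    rw [← h1] at h2
    simp [Fin.ext_iff] at h2
  by_cases ha : a = 0 <;> by_cases hb : b = 0
  · obtain ⟨i, hi, -⟩ := hex 0
    obtain ⟨j, hj, hji⟩ := hex i
    refine ⟨((i, i), (j, j)), fun c d => ?_⟩
    simp only [minorCoeff, productTensor, Prod.mk.injEq]
    grind
  · obtain ⟨j, hj, hji⟩ := hex b
    refine ⟨((j, j), (0, b)), fun c d => ?_⟩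
    simp only [minorCoeff, productTensor, Prod.mk.injEq]
    grind
  · obtain ⟨j, hj, hji⟩ := hex a
    refine ⟨((0, a), (j, j)), fun c d => ?_⟩
    simp only [minorCoeff, productTensor, Prod.mk.injEq]
    grind
  · refine ⟨((a, 0), (0, b)), fun c d => ?_⟩
    simp only [minorCoeff, productTensor, Prod.mk.injEq]
    grind

/-- The polynomial in the coefficients of a form `F` whose value is `∂_i ∂_j ∂_k F` at `0`. -/
noncomputable def tensorPoly (i j k : Fin (n + 1)) : MvPolynomial (Fin (n + 1) →₀ ℕ) ℂ :=
  let m := Finsupp.single i 1 + Finsupp.single j 1 + Finsupp.single k 1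
  C (∏ a, ((m a).factorial : ℂ)) * X m

theorem eval_tensorPoly (F : MvPolynomial (Fin (n + 1)) ℂ) (i j k : Fin (n + 1)) :
    eval (fun m => coeff m F) (tensorPoly i j k) = apolarFunctional F (X i * X j * X k) := by
  have h : X i * X j * X k = monomial (Finsupp.single i 1 + Finsupp.single j 1 +
      Finsupp.single k 1) (1 : ℂ) := by
    rw [X, X, X, monomial_mul, monomial_mul, one_mul, one_mul]
  rw [h, apolarFunctional_monomial, tensorPoly, map_mul, eval_C, eval_X]

theorem eval_det_minorCoeff (r : Fin (n + 1) × Fin (n + 1) →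
      (Fin (n + 1) × Fin (n + 1)) × Fin (n + 1) × Fin (n + 1))
    (F : MvPolynomial (Fin (n + 1)) ℂ) :
    eval (fun m => coeff m F) (Matrix.of fun a b : Fin (n + 1) × Fin (n + 1) =>
      minorCoeff tensorPoly (r a) b.1 b.2).det =
    (Matrix.of fun a b : Fin (n + 1) × Fin (n + 1) =>
      minorCoeff (fun i j k => apolarFunctional F (X i * X j * X k)) (r a) b.1 b.2).det := by
  rw [RingHom.map_det]
  congr 1
  ext a b
  simp [minorCoeff, eval_tensorPoly]

/-- The reducible cubic form `x_0 (x_1 ^ 2 + ⋯ + x_n ^ 2)`. -/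
noncomputable def standardCubic (n : ℕ) : MvPolynomial (Fin (n + 1)) ℂ :=
  X 0 * ∑ i : Fin n, X i.succ ^ 2

theorem apolarFunctional_standardCubic (i j k : Fin (n + 1)) :
    apolarFunctional (standardCubic n) (X i * X j * X k) =
      productTensor (fun i => if i = 0 then (1 : ℂ) else 0)
        (fun i j => if i = j then if i = 0 then 0 else 2 else 0) i j k := by
  rw [standardCubic, apolarFunctional_mul_of_isHomogeneous (isHomogeneous_X _ _)
    (IsHomogeneous.sum _ _ _ fun i _ => by simpa using (isHomogeneous_X ℂ i.succ).pow 2)]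
  congr 1
  · ext i
    simp [pderiv_X, Pi.single_apply, apply_ite, eq_comm]
  · ext i j
    have h : pderiv j (∑ i : Fin n, (X i.succ : MvPolynomial (Fin (n + 1)) ℂ) ^ 2) =
        if j = 0 then 0 else C 2 * X j := by
      simp only [map_sum, pderiv_pow, pderiv_X, Pi.single_apply]
      refine Fin.cases ?_ (fun j => ?_) j
      · simp [Fin.succ_ne_zero]
      · simp [Fin.succ_ne_zero, Finset.sum_ite_eq', ← map_ofNat (C (R := ℂ) (σ := Fin (n + 1)))]
    rw [h]
    clear h
    by_cases h1 : i = j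
    · subst h1
      by_cases h2 : i = 0 <;> simp [h2]
    · by_cases h2 : j = 0 <;> simp [h1, h2, pderiv_X, Ne.symm h1]

/-- The linear form whose coefficients are the entries of the row `a` of `V`. -/
noncomputable def linForm {R : Type*} [CommRing R] (V : Matrix (Fin (n + 1)) (Fin (n + 1)) R)
    (a : Fin (n + 1)) : CoordRing R n := ∑ j, C (V a j) * X j

theorem isHomogeneous_linForm {R : Type*} [CommRing R]
    (V : Matrix (Fin (n + 1)) (Fin (n + 1)) R) (a : Fin (n + 1)) :
    (linForm V a).IsHomogeneous 1 :=
  IsHomogeneous.sum _ _ _ fun j _ => isHomogeneous_C_mul_X _ j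

theorem apolarFunctional_linForm {F : MvPolynomial (Fin (n + 1)) ℂ} {l : Fin (n + 1) → ℂ}
    {A V : Matrix (Fin (n + 1)) (Fin (n + 1)) ℂ}
    (h : ∀ i j k, apolarFunctional F (X i * X j * X k) = productTensor l A i j k)
    (a b c : Fin (n + 1)) :
    apolarFunctional F (linForm V a * linForm V b * linForm V c) =
      productTensor (fun a => V a ⬝ᵥ l) (fun a b => V a ⬝ᵥ A.mulVec (V b)) a b c := by
  have h1 : linForm V a * linForm V b * linForm V c =
      ∑ i, ∑ j, ∑ k, (V a i * V b j * V c k) • (X i * X j * X k) := by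
    rw [linForm, linForm, linForm, Finset.sum_mul_sum, Finset.sum_mul]
    refine Finset.sum_congr rfl fun i _ => ?_
    rw [Finset.sum_mul]
    refine Finset.sum_congr rfl fun j _ => ?_
    rw [Finset.mul_sum]
    refine Finset.sum_congr rfl fun k _ => ?_
    rw [MvPolynomial.smul_eq_C_mul, C_mul, C_mul]
    ring
  have h2 : ∀ a b, V a ⬝ᵥ A.mulVec (V b) = ∑ i, ∑ j, V a i * V b j * A i j := by
    intro a b
    simp only [dotProduct, Matrix.mulVec, Finset.mul_sum]
    exact Finset.sum_congr rfl fun i _ => Finset.sum_congr rfl fun j _ => by ring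
  have h3 : ∀ a, V a ⬝ᵥ l = ∑ i, V a i * l i := fun a => rfl
  rw [h1]
  simp only [map_sum, map_smul, h, smul_eq_mul]
  simp only [productTensor, h2, h3]
  have e1 : (∑ i, V a i * l i) * ∑ j, ∑ k, V b j * V c k * A j k =
      ∑ i, ∑ j, ∑ k, V a i * V b j * V c k * (l i * A j k) := by
    rw [Finset.sum_mul]
    simp only [Finset.mul_sum]
    refine Finset.sum_congr rfl fun i _ => Finset.sum_congr rfl fun j _ =>
      Finset.sum_congr rfl fun k _ => by ring
  have e2 : (∑ j, V b j * l j) * ∑ i, ∑ k, V a i * V c k * A i k =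
      ∑ i, ∑ j, ∑ k, V a i * V b j * V c k * (l j * A i k) := by
    rw [Finset.sum_mul]
    simp only [Finset.mul_sum]
    rw [Finset.sum_comm]
    refine Finset.sum_congr rfl fun i _ => Finset.sum_congr rfl fun j _ =>
      Finset.sum_congr rfl fun k _ => by ring
  have e3 : (∑ k, V c k * l k) * ∑ i, ∑ j, V a i * V b j * A i j =
      ∑ i, ∑ j, ∑ k, V a i * V b j * V c k * (l k * A i j) := by
    rw [Finset.sum_mul]
    simp only [Finset.mul_sum]
    rw [Finset.sum_comm]
    refine Finset.sum_congr rfl fun i _ => ?_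
    rw [Finset.sum_comm]
    refine Finset.sum_congr rfl fun j _ =>
      Finset.sum_congr rfl fun k _ => by ring
  rw [e1, e2, e3]
  simp only [← Finset.sum_add_distrib]
  refine Finset.sum_congr rfl fun i _ => Finset.sum_congr rfl fun j _ =>
      Finset.sum_congr rfl fun k _ => by ring

theorem standardCubic_mem (hn : 1 < n) : standardCubic n ∈ reducibleCubicForms n := by
  refine ⟨?_, fun h0 => ?_, fun hirr => ?_⟩
  · exact (isHomogeneous_X ℂ (0 : Fin (n + 1))).mul (IsHomogeneous.sum _ _ 2 fun i _ => by
      simpa using (isHomogeneous_X ℂ i.succ).pow 2)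
  · have h := apolarFunctional_standardCubic (n := n) 0 (Fin.last n) (Fin.last n)
    rw [h0, apolarFunctional_apply, map_zero, map_zero] at h
    have hl : Fin.last n ≠ 0 := by simp [Fin.ext_iff]; omega
    simp [productTensor, hl] at h
  · rcases hirr.isUnit_or_isUnit rfl with h | h
    · simpa using h.map constantCoeff
    · simpa using h.map constantCoeff

/-- In coordinates adapted to `F`, its tensor is that of `x_0 (c x_0 ^ 2 + x_1 ^ 2 + ⋯ + x_n ^ 2)`
up to constant factors. The coordinate forms are the rows of `V`, with inverse matrix `W`. -/
structure IsNormalized (F : MvPolynomial (Fin (n + 1)) ℂ)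
    (V W : Matrix (Fin (n + 1)) (Fin (n + 1)) ℂ) (c : ℂ) : Prop where
  mul_eq_one : V * W = 1
  mul_eq_one' : W * V = 1
  apply_linForm : ∀ i j k, apolarFunctional F (linForm V i * linForm V j * linForm V k) =
    productTensor (fun i => if i = 0 then 1 else 0)
      (fun i j => if i = j then if i = 0 then c else 1 else 0) i j k

theorem holdsForGeneral_isNormalized (hn : 1 < n) :
    HoldsForGeneral (reducibleCubicForms n) fun F => ∃ V W c, IsNormalized F V W c := by
  choose r hr using exists_minor_eq_single hn
  refine ⟨(Matrix.of fun a b : Fin (n + 1) × Fin (n + 1) =>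
      minorCoeff tensorPoly (r a) b.1 b.2).det, ⟨standardCubic n, standardCubic_mem hn, ?_⟩, ?_⟩
  · rw [eval_det_minorCoeff]
    have hdiag : (Matrix.of fun a b : Fin (n + 1) × Fin (n + 1) =>
        minorCoeff (fun i j k => apolarFunctional (standardCubic n) (X i * X j * X k)) (r a)
          b.1 b.2) = Matrix.diagonal fun _ => 4 := by
      ext a b
      simp only [apolarFunctional_standardCubic, Matrix.of_apply]
      rw [hr, Matrix.diagonal_apply]
    rw [hdiag, Matrix.det_diagonal]
    exact Finset.prod_ne_zero_iff.2 fun _ _ => by norm_num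
  · intro F hF hP
    rw [eval_det_minorCoeff] at hP
    obtain ⟨f, q, hf, hq, rfl⟩ := exists_linear_mul_quadratic hF
    have hT := apolarFunctional_mul_of_isHomogeneous hf hq
    set l : Fin (n + 1) → ℂ := fun i => constantCoeff (pderiv i f)
    let A : Matrix (Fin (n + 1)) (Fin (n + 1)) ℂ :=
      Matrix.of fun i j => constantCoeff (pderiv i (pderiv j q))
    have hA : A.IsSymm := Matrix.ext fun i j => constantCoeff_pderiv_comm q j i
    have hw : ∀ w : Fin (n + 1) → ℂ, ∀ i j,
        ∑ c, apolarFunctional (f * q) (X i * X j * X c) * w c =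
          l i * A.mulVec w j + l j * A.mulVec w i + A i j * (l ⬝ᵥ w) := by
      intro w i j
      simp only [hT, productTensor, Matrix.mulVec, dotProduct, Finset.mul_sum,
        ← Finset.sum_add_distrib]
      exact Finset.sum_congr rfl fun c _ => by simp only [A, Matrix.of_apply]; ring
    -- for `l = 0` the Hessian matrix would vanish at every `w`
    have hl : l ≠ 0 := by
      intro hl
      have h := eq_zero_of_minors hP (w := 1) (u := 0) (α := 0) fun i j => by
        rw [hw, hl]; simp
      simpa using congrFun h 0
    obtain ⟨V, W, c, hVW, hWV, hVl, hVA⟩ := exists_basis_diagonal hl hA fun w hlw ⟨α, hα⟩ =>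
      eq_zero_of_minors hP (w := w) (u := l) (α := 2 * α) fun i j => by
        rw [hw, hα, hlw]
        simp only [Pi.smul_apply, smul_eq_mul]
        ring
    refine ⟨V, W, c, hVW, hWV, fun i j k => ?_⟩
    rw [apolarFunctional_linForm (A := A) hT]
    simp only [hVl, hVA]

end Genericity

/-! ### Saturated ideals and monotonicity of the Hilbert function -/

section NonZeroDivisor

variable {k : Type*} [Field k] {n : ℕ}

/-- The irrelevant ideal is not contained in any of the finitely many associated primes of
a saturated ideal, so some linear form lies in none of them. -/
theorem exists_linear_nonZeroDivisor [Infinite k] {I : Ideal (CoordRing k n)}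
    (hI : IsSubschemeIdeal I) :
    ∃ z : CoordRing k n, z.IsHomogeneous 1 ∧ ∀ g, z * g ∈ I → g ∈ I := by
  by_contra! hcon
  let T := CoordRing k n
  have hfin : Finite (associatedPrimes T (T ⧸ I)) := associatedPrimes.finite T (T ⧸ I)
  let p : associatedPrimes T (T ⧸ I) → Subspace k (homogeneousSubmodule (Fin (n + 1)) k 1) :=
    fun P => (P.1.restrictScalars k).submoduleOf _
  obtain ⟨P, hP⟩ := Subspace.exists_eq_top_of_iUnion_eq_univ (p := p) (by
    refine Set.eq_univ_of_forall fun ⟨z, hz⟩ => ?_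
    obtain ⟨g, hzg, hg⟩ := hcon z hz
    have hmem : z ∈ ⋃ P ∈ associatedPrimes T (T ⧸ I), (P : Set T) := by
      rw [biUnion_associatedPrimes_eq_zero_divisors]
      refine ⟨Ideal.Quotient.mk I g, fun h => hg (Ideal.Quotient.eq_zero_iff_mem.1 h), ?_⟩
      exact Ideal.Quotient.eq_zero_iff_mem.2 hzg
    obtain ⟨P, hP, hzP⟩ := Set.mem_iUnion₂.1 hmem
    exact Set.mem_iUnion.2 ⟨⟨P, hP⟩, hzP⟩)
  obtain ⟨hprime, x, hx⟩ := isAssociatedPrime_iff.1 P.2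
  obtain ⟨g, rfl⟩ := Ideal.Quotient.mk_surjective x
  have hle : irrelevantIdeal k n ≤ P.1 := by
    refine Ideal.span_le.2 ?_
    rintro _ ⟨i, rfl⟩
    have : (⟨X i, isHomogeneous_X k i⟩ : homogeneousSubmodule (Fin (n + 1)) k 1) ∈ p P :=
      hP ▸ Submodule.mem_top
    exact this
  have hann : ∀ q ∈ P.1, q * g ∈ I := fun q hq => by
    rw [hx] at hq
    exact Ideal.Quotient.eq_zero_iff_mem.1
      (show q • Ideal.Quotient.mk I g = 0 by simpa using hq)
  have hg : g ∈ I := by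
    rw [← hI.2]
    exact ⟨1, fun q hq => hann q (hle (by rwa [pow_one] at hq))⟩
  refine hprime.ne_top ((Ideal.eq_top_iff_one _).2 ?_)
  rw [hx]
  simpa using Ideal.Quotient.eq_zero_iff_mem.2 hg

instance finiteDimensional_homogeneousSubmodule (d : ℕ) :
    FiniteDimensional k (homogeneousSubmodule (Fin (n + 1)) k d) :=
  Module.Finite.iff_fg.2 (homogeneousSubmodule_fg _ _ d)

theorem hilbertFunction_mono {I : Ideal (CoordRing k n)} {z : CoordRing k n}
    (hz : z.IsHomogeneous 1) (hzI : ∀ g, z * g ∈ I → g ∈ I) {d e : ℕ} (hde : d ≤ e) :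
    hilbertFunction I d ≤ hilbertFunction I e := by
  have hpow : ∀ m g, z ^ m * g ∈ I → g ∈ I := by
    intro m
    induction m with
    | zero => intro g hg; simpa using hg
    | succ m ih => intro g hg; exact ih g (hzI _ (by rwa [← mul_assoc, ← pow_succ']))
  let f : homogeneousSubmodule (Fin (n + 1)) k d →ₗ[k] homogeneousSubmodule (Fin (n + 1)) k e :=
    ((LinearMap.mulLeft k (z ^ (e - d))).comp (Submodule.subtype _)).codRestrict _ fun g => by
      have h := (hz.pow (e - d)).mul g.2
      rw [one_mul, Nat.sub_add_cancel hde] at h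
      exact h
  refine LinearMap.finrank_le_finrank_of_injective
    (f := Submodule.mapQ ((I.restrictScalars k).submoduleOf _)
      ((I.restrictScalars k).submoduleOf _) f fun g hg => I.mul_mem_left _ hg) ?_
  refine (injective_iff_map_eq_zero _).2 fun x hx => ?_
  obtain ⟨g, rfl⟩ := Submodule.Quotient.mk_surjective _ x
  have hx' : (Submodule.Quotient.mk (f g) : _ ⧸ (I.restrictScalars k).submoduleOf _) = 0 := hx
  have hfg : f g ∈ (I.restrictScalars k).submoduleOf _ := (Submodule.Quotient.mk_eq_zero _).1 hx'
  exact (Submodule.Quotient.mk_eq_zero ((I.restrictScalars k).submoduleOf _)).2 (hpow _ _ hfg)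

end NonZeroDivisor

/-! ### The lower bound -/

section LowerBound

variable {n : ℕ}

theorem sum_mul_linForm {R : Type*} [CommRing R] {V W : Matrix (Fin (n + 1)) (Fin (n + 1)) R}
    (h : W * V = 1) (j : Fin (n + 1)) : ∑ i, C (W j i) * linForm V i = X j := by
  simp only [linForm, Finset.mul_sum]
  rw [Finset.sum_comm]
  have h1 : ∀ a, ∑ i, C (W j i) * (C (V i a) * X a) =
      C ((1 : Matrix (Fin (n + 1)) (Fin (n + 1)) R) j a) * (X a : CoordRing R n) := by
    intro a
    rw [← h, Matrix.mul_apply, map_sum, Finset.sum_mul]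
    exact Finset.sum_congr rfl fun i _ => by rw [C_mul, mul_assoc]
  rw [Finset.sum_congr rfl fun a _ => h1 a]
  simp [Matrix.one_apply, apply_ite]

/-- If the length were at most `n + 1`, the ideal would contain all quadrics apolar to `F`. These
contain `z_i z_j`, `z_i ^ 2 - z_j ^ 2` and `z_0 ^ 2 - 3 c z_i ^ 2` for `i, j > 0`, whose common
zero set in projective space is empty. -/
theorem IsNormalized.le_length (hn : 1 < n) {F : MvPolynomial (Fin (n + 1)) ℂ}
    {V W : Matrix (Fin (n + 1)) (Fin (n + 1)) ℂ} {c : ℂ} (hF : IsNormalized F V W c)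
    {I : Ideal (CoordRing ℂ n)} {r : ℕ} (hI : IsZeroDimOfLength I r) (hIF : IsApolar I F) :
    n + 2 ≤ r := by
  obtain ⟨hsub, hr, d₀, hd₀⟩ := hI
  by_contra! hlt
  obtain ⟨z, hz, hzI⟩ := exists_linear_nonZeroDivisor hsub
  have h2 : hilbertFunction I 2 ≤ n + 1 := by
    have h := hilbertFunction_mono hz hzI (le_max_left 2 d₀)
    rw [hd₀ _ (le_max_right 2 d₀)] at h
    omega
  have hI0 := isApolar_iff.1 hIF
  -- `L` maps a quadric `g` modulo `I` to the pairings of `g z_k` with `F`, where `z_k` are the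
  -- coordinate forms; it is surjective, hence injective by the bound on the dimension
  let L₀ : CoordRing ℂ n →ₗ[ℂ] (Fin (n + 1) → ℂ) :=
    LinearMap.pi fun k => apolarFunctional F ∘ₗ LinearMap.mulRight ℂ (linForm V k)
  let L := ((I.restrictScalars ℂ).submoduleOf (homogeneousSubmodule (Fin (n + 1)) ℂ 2)).liftQ
    (L₀.comp (Submodule.subtype _)) fun g hg => by
      ext k
      exact hI0 _ (I.mul_mem_right _ hg)
  have hquad : ∀ i j, (linForm V i * linForm V j).IsHomogeneous 2 := fun i j =>
    (isHomogeneous_linForm V i).mul (isHomogeneous_linForm V j)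
  have hsurj : Function.Surjective L := by
    rw [← LinearMap.range_eq_top, eq_top_iff, ← (Pi.basisFun ℂ (Fin (n + 1))).span_eq,
      Submodule.span_le]
    rintro _ ⟨i, rfl⟩
    by_cases hi : i = 0
    · refine ⟨Submodule.Quotient.mk ⟨_, hquad (Fin.last n) (Fin.last n)⟩, ?_⟩
      have hl : Fin.last n ≠ 0 := by simp [Fin.ext_iff]; omega
      ext k
      refine (hF.apply_linForm _ _ k).trans ?_
      by_cases hk : k = 0 <;> simp [productTensor, hl, hi, hk]
    · refine ⟨Submodule.Quotient.mk ⟨_, hquad 0 i⟩, ?_⟩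
      ext k
      refine (hF.apply_linForm _ _ k).trans ?_
      by_cases hk : k = i
      · simp [productTensor, hi, hk]
      · by_cases hk0 : k = 0
        · simp [productTensor, hk0, hi, Ne.symm hi]
        · simp [productTensor, hi, hk, hk0, Ne.symm hk, Ne.symm hk0]
  have hinj : Function.Injective L := by
    have h3 := LinearMap.finrank_le_finrank_of_surjective hsurj
    rw [Module.finrank_fin_fun] at h3
    refine (LinearMap.injective_iff_surjective_of_finrank_eq_finrank ?_).2 hsurj
    rw [Module.finrank_fin_fun]
    exact le_antisymm h2 h3
  have hmem : ∀ g : CoordRing ℂ n, g.IsHomogeneous 2 →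
      (∀ k, apolarFunctional F (g * linForm V k) = 0) → g ∈ I := by
    intro g hg h
    have h0 : L (Submodule.Quotient.mk ⟨g, hg⟩) = 0 := funext h
    exact (Submodule.Quotient.mk_eq_zero ((I.restrictScalars ℂ).submoduleOf _)).1 (hinj (h0.trans (map_zero L).symm))
  have hex : ∀ i : Fin (n + 1), ∃ j : Fin (n + 1), j ≠ 0 ∧ j ≠ i := by
    intro i
    by_contra! h
    have h1 := h ⟨1, by omega⟩ (by simp [Fin.ext_iff])
    have h2 := h ⟨2, by omega⟩ (by simp [Fin.ext_iff])
    rw [← h1] at h2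
    simp [Fin.ext_iff] at h2
  have hrad_pos : ∀ i, i ≠ 0 → linForm V i ∈ I.radical := by
    intro i hi
    obtain ⟨j, hj, hji⟩ := hex i
    have h1 := hmem _ (hquad i j) fun k => by
      rw [hF.apply_linForm]
      simp [productTensor, hi, hj, Ne.symm hji]
    have h2 := hmem _ ((hquad i i).sub (hquad j j)) fun k => by
      rw [sub_mul, map_sub, hF.apply_linForm, hF.apply_linForm]
      simp [productTensor, hi, hj]
    -- `z_i ^ 3 = z_i (z_i ^ 2 - z_j ^ 2) + z_j (z_i z_j)`
    refine ⟨3, ?_⟩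
    have h3 := I.add_mem (I.mul_mem_left (linForm V i) h2) (I.mul_mem_left (linForm V j) h1)
    convert h3 using 1
    ring
  have hrad : ∀ i, linForm V i ∈ I.radical := by
    intro i
    by_cases hi : i = 0
    · obtain ⟨j, hj, -⟩ := hex 0
      have h1 := hmem _ ((hquad 0 0).sub ((hquad j j).C_mul (3 * c))) fun k => by
        rw [sub_mul, map_sub, ← MvPolynomial.smul_eq_C_mul, smul_mul_assoc, map_smul,
          hF.apply_linForm, hF.apply_linForm]
        by_cases hk : k = 0
        · simp [productTensor, hj, hk]; ring
        · simp [productTensor, hj, hk, Ne.symm hk]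
      have h2 := I.radical.add_mem (Ideal.le_radical h1)
        (I.radical.mul_mem_left (C (3 * c) * linForm V j) (hrad_pos j hj))
      rw [hi]
      refine Ideal.radical_idem I ▸ ⟨2, ?_⟩
      convert h2 using 1
      ring
    · exact hrad_pos i hi
  have hle : irrelevantIdeal ℂ n ≤ I.radical := by
    refine Ideal.span_le.2 ?_
    rintro _ ⟨j, rfl⟩
    change X j ∈ I.radical
    rw [← sum_mul_linForm hF.mul_eq_one' j]
    exact Ideal.sum_mem _ fun i _ => Ideal.mul_mem_left _ _ (hrad i)
  obtain ⟨N, hN⟩ := Ideal.exists_pow_le_of_le_radical_of_fg hle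
    (IsNoetherian.noetherian (irrelevantIdeal ℂ n))
  have hone : (1 : CoordRing ℂ n) ∈ I := by
    rw [← hsub.2]
    exact ⟨N, fun p hp => by rw [mul_one]; exact hN hp⟩
  have hzero : hilbertFunction I d₀ = 0 := by
    have : Subsingleton (homogeneousSubmodule (Fin (n + 1)) ℂ d₀ ⧸
        (I.restrictScalars ℂ).submoduleOf (homogeneousSubmodule (Fin (n + 1)) ℂ d₀)) := by
      refine Submodule.Quotient.subsingleton_iff.2 (eq_top_iff.2 fun g _ => ?_)
      exact (Ideal.eq_top_iff_one I).2 hone ▸ Submodule.mem_top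
    exact Module.finrank_zero_of_subsingleton
  rw [hd₀ d₀ le_rfl] at hzero
  omega

end LowerBound

/-! ### An apolar local scheme of length at most `n + 2` -/

section TangentQuadric

variable {n : ℕ}

/-- The ideal of the local Gorenstein scheme of length `n + 2` at the origin of affine `n`-space
which is defined by `s_1 ^ 2 + ⋯ + s_n ^ 2`: its elements have order at least `2`, and
a quadratic part of trace zero. -/
def traceIdeal (n : ℕ) : Ideal (MvPolynomial (Fin n) ℂ) where
  carrier := {f | coeff 0 f = 0 ∧ (∀ i, coeff (Finsupp.single i 1) f = 0) ∧
    ∑ i, coeff (Finsupp.single i 2) f = 0}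
  zero_mem' := by simp
  add_mem' := by
    rintro f g ⟨h1, h2, h3⟩ ⟨h1', h2', h3'⟩
    simp [h1, h2, h3, h1', h2', h3', Finset.sum_add_distrib]
  smul_mem' := by
    rintro g f ⟨h1, h2, h3⟩
    refine ⟨by simp [coeff_mul, h1], fun i => ?_, ?_⟩
    · rw [smul_eq_mul, coeff_mul, Finsupp.antidiagonal_single, Finset.sum_map]
      simp [Finset.Nat.antidiagonal_succ, h1, h2]
    · have h : ∀ i, coeff (Finsupp.single i 2) (g • f) =
          coeff 0 g * coeff (Finsupp.single i 2) f := fun i => by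
        rw [smul_eq_mul, coeff_mul, Finsupp.antidiagonal_single, Finset.sum_map]
        simp [Finset.Nat.antidiagonal_succ, h1, h2]
      rw [Finset.sum_congr rfl fun i _ => h i, ← Finset.mul_sum, h3, mul_zero]

theorem mem_traceIdeal {f : MvPolynomial (Fin n) ℂ} : f ∈ traceIdeal n ↔ coeff 0 f = 0 ∧
    (∀ i, coeff (Finsupp.single i 1) f = 0) ∧ ∑ i, coeff (Finsupp.single i 2) f = 0 := Iff.rfl

theorem finrank_quotient_traceIdeal_le : FiniteDimensional ℂ (MvPolynomial (Fin n) ℂ ⧸ traceIdeal n) ∧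
    Module.finrank ℂ (MvPolynomial (Fin n) ℂ ⧸ traceIdeal n) ≤ n + 2 := by
  let L : MvPolynomial (Fin n) ℂ →ₗ[ℂ] ℂ × (Fin n → ℂ) × ℂ :=
    (lcoeff ℂ 0).prod ((LinearMap.pi fun i => lcoeff ℂ (Finsupp.single i 1)).prod
      (∑ i, lcoeff ℂ (Finsupp.single i 2)))
  have hL : ∀ f, L f = 0 → f ∈ traceIdeal n := by
    intro f hf
    simpa [L, funext_iff, mem_traceIdeal] using hf
  obtain ⟨hfin, hle⟩ := finrank_quotient_le L hL
  refine ⟨hfin, hle.trans (le_of_eq ?_)⟩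
  simp [Module.finrank_prod]
  ring

instance : Nontrivial (MvPolynomial (Fin n) ℂ ⧸ traceIdeal n) := by
  refine Ideal.Quotient.nontrivial_iff.2 fun h => ?_
  have h1 : (1 : MvPolynomial (Fin n) ℂ) ∈ traceIdeal n := h ▸ Submodule.mem_top
  simpa using h1.1

/-- The affine chart of projective space in which the coordinate forms `linForm V i`, with `V`
inverse to `W`, become `1, s_1, …, s_n`. -/
noncomputable def affineChart {R : Type*} [CommRing R] (W : Matrix (Fin (n + 1)) (Fin (n + 1)) R)
    (j : Fin (n + 1)) : MvPolynomial (Fin n) R :=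
  ∑ i, C (W j i) * (Fin.cons 1 X : Fin (n + 1) → MvPolynomial (Fin n) R) i

theorem aeval_affineChart_linForm {R : Type*} [CommRing R]
    {V W : Matrix (Fin (n + 1)) (Fin (n + 1)) R} (h : V * W = 1) (a : Fin (n + 1)) :
    aeval (affineChart W) (linForm V a) =
      (Fin.cons 1 X : Fin (n + 1) → MvPolynomial (Fin n) R) a := by
  simp only [linForm, affineChart, map_sum, map_mul, aeval_X, aeval_C, Finset.mul_sum,
    algebraMap_eq]
  rw [Finset.sum_comm]
  have h1 : ∀ i, ∑ j, C (V a j) * (C (W j i) *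
      (Fin.cons 1 X : Fin (n + 1) → MvPolynomial (Fin n) R) i) =
      C ((1 : Matrix (Fin (n + 1)) (Fin (n + 1)) R) a i) *
        (Fin.cons 1 X : Fin (n + 1) → MvPolynomial (Fin n) R) i := by
    intro i
    rw [← h, Matrix.mul_apply, map_sum, Finset.sum_mul]
    exact Finset.sum_congr rfl fun j _ => by rw [C_mul, mul_assoc]
  rw [Finset.sum_congr rfl fun i _ => h1 i]
  simp [Matrix.one_apply, apply_ite]

open scoped Pointwise in
theorem homogeneousSubmodule_three_eq_span {V W : Matrix (Fin (n + 1)) (Fin (n + 1)) ℂ}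
    (h : W * V = 1) : homogeneousSubmodule (Fin (n + 1)) ℂ 3 =
      Submodule.span ℂ {g | ∃ i j k, linForm V i * linForm V j * linForm V k = g} := by
  have h1 : homogeneousSubmodule (Fin (n + 1)) ℂ 1 = Submodule.span ℂ (Set.range (linForm V)) := by
    refine le_antisymm ?_ (Submodule.span_le.2 ?_)
    · rw [homogeneousSubmodule_one_eq_span_X, Submodule.span_le]
      rintro _ ⟨j, rfl⟩
      rw [← sum_mul_linForm h j]
      refine Submodule.sum_mem _ fun i _ => ?_
      rw [← MvPolynomial.smul_eq_C_mul]
      exact Submodule.smul_mem _ _ (Submodule.subset_span ⟨i, rfl⟩)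
    · rintro _ ⟨i, rfl⟩
      exact isHomogeneous_linForm V i
  rw [← homogeneousSubmodule_one_pow, h1, Submodule.span_pow, pow_succ, pow_two]
  congr 1
  ext g
  simp only [Set.mem_mul, Set.mem_range, Set.mem_ofPred_eq]
  constructor
  · rintro ⟨_, ⟨_, ⟨i, rfl⟩, _, ⟨j, rfl⟩, rfl⟩, _, ⟨k, rfl⟩, rfl⟩
    exact ⟨i, j, k, rfl⟩
  · rintro ⟨i, j, k, rfl⟩
    exact ⟨_, ⟨_, ⟨i, rfl⟩, _, ⟨j, rfl⟩, rfl⟩, _, ⟨k, rfl⟩, rfl⟩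

/-- The ideal in `ℂ[y_0, …, y_n]` of the scheme defined by `traceIdeal n` in the chart given
by `W`. -/
noncomputable def traceProjIdeal (W : Matrix (Fin (n + 1)) (Fin (n + 1)) ℂ) :
    Ideal (CoordRing ℂ n) :=
  projIdeal fun j => Ideal.Quotient.mkₐ ℂ (traceIdeal n) (affineChart W j)

theorem aeval_mk_affineChart (W : Matrix (Fin (n + 1)) (Fin (n + 1)) ℂ) (g : CoordRing ℂ n) :
    aeval (fun j => Ideal.Quotient.mkₐ ℂ (traceIdeal n) (affineChart W j)) g =
      Ideal.Quotient.mkₐ ℂ (traceIdeal n) (aeval (affineChart W) g) := by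
  rw [← AlgHom.comp_apply]
  congr 1
  ext j
  simp

theorem aeval_mk_affineChart_eq_zero {W : Matrix (Fin (n + 1)) (Fin (n + 1)) ℂ}
    {g : CoordRing ℂ n} :
    aeval (fun j => Ideal.Quotient.mkₐ ℂ (traceIdeal n) (affineChart W j)) g = 0 ↔
      aeval (affineChart W) g ∈ traceIdeal n := by
  rw [aeval_mk_affineChart, Ideal.Quotient.mkₐ_eq_mk, Ideal.Quotient.eq_zero_iff_mem]

theorem mem_traceProjIdeal {W : Matrix (Fin (n + 1)) (Fin (n + 1)) ℂ} {g : CoordRing ℂ n} :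
    g ∈ traceProjIdeal W ↔
      ∀ d, aeval (affineChart W) (homogeneousComponent d g) ∈ traceIdeal n := by
  simp only [traceProjIdeal, mem_projIdeal, aeval_mk_affineChart_eq_zero]

theorem IsNormalized.isApolar {F : MvPolynomial (Fin (n + 1)) ℂ}
    {V W : Matrix (Fin (n + 1)) (Fin (n + 1)) ℂ} {c : ℂ} (h : IsNormalized F V W c)
    (hF : F.IsHomogeneous 3) : IsApolar (traceProjIdeal W) F := by
  -- in the chart, the apolarity pairing with `F` sees of a cubic form, as a polynomial in
  -- `s_1, …, s_n`, only the constant term and the trace of the quadratic part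
  let ψ : MvPolynomial (Fin n) ℂ →ₗ[ℂ] ℂ :=
    (3 * c) • lcoeff ℂ 0 + ∑ i, lcoeff ℂ (Finsupp.single i 2)
  have hψ : ∀ f, ψ f = 3 * c * coeff 0 f + ∑ i, coeff (Finsupp.single i 2) f := fun f => by
    simp [ψ]
  have hkey : ∀ g ∈ homogeneousSubmodule (Fin (n + 1)) ℂ 3,
      apolarFunctional F g = ψ (aeval (affineChart W) g) := by
    rw [homogeneousSubmodule_three_eq_span h.mul_eq_one']
    refine LinearMap.eqOn_span (f := apolarFunctional F)
      (g := ψ ∘ₗ (aeval (affineChart W)).toLinearMap) ?_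
    rintro _ ⟨i, j, k, rfl⟩
    rw [h.apply_linForm, LinearMap.comp_apply, AlgHom.toLinearMap_apply, map_mul (aeval _), map_mul (aeval _),
      aeval_affineChart_linForm h.mul_eq_one, aeval_affineChart_linForm h.mul_eq_one,
      aeval_affineChart_linForm h.mul_eq_one, hψ]
    have c0 : ∀ (p : MvPolynomial (Fin n) ℂ) (i : Fin n), coeff 0 (p * X i) = 0 := fun p i => by
      rw [← constantCoeff_eq, map_mul, constantCoeff_X, mul_zero]
    have c1 : ∀ i j : Fin n, coeff (Finsupp.single j 2) (X i : MvPolynomial (Fin n) ℂ) = 0 :=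
      fun i j => (isHomogeneous_X ℂ i).coeff_eq_zero (by simp)
    have c2 : ∀ i j k : Fin n, coeff (Finsupp.single k 2) (X i * X j : MvPolynomial (Fin n) ℂ) =
        if i = j then if k = i then 1 else 0 else 0 := fun i j k => by
      rw [coeff_mul_X', coeff_X]
      by_cases hk : j = k
      · subst hk
        simp [← Finsupp.single_tsub, Finsupp.single_left_inj, eq_comm]
      · simp [hk]
        grind
    have c3 : ∀ i j k m : Fin n,
        coeff (Finsupp.single m 2) (X i * X j * X k : MvPolynomial (Fin n) ℂ) = 0 :=
      fun i j k m => (((isHomogeneous_X ℂ i).mul (isHomogeneous_X ℂ j)).mul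
        (isHomogeneous_X ℂ k)).coeff_eq_zero (by simp)
    have c4 : ∀ m : Fin n, coeff (Finsupp.single m 2) (1 : MvPolynomial (Fin n) ℂ) = 0 :=
      fun m => (isHomogeneous_one (Fin n) ℂ).coeff_eq_zero (by simp)
    refine Fin.cases ?_ (fun i => ?_) i <;> refine Fin.cases ?_ (fun j => ?_) j <;>
      refine Fin.cases ?_ (fun k => ?_) k <;>
      simp [productTensor, c0, c1, c2, c3, c4, Fin.succ_ne_zero, (Fin.succ_ne_zero _).symm]
    ring
  refine isApolar_projIdeal hF fun g hg hg0 => ?_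
  obtain ⟨h1, -, h3⟩ := aeval_mk_affineChart_eq_zero.1 hg0
  rw [hkey g hg, hψ, h1, h3, mul_zero, zero_add]

theorem isZeroDimOfLength_traceProjIdeal {V W : Matrix (Fin (n + 1)) (Fin (n + 1)) ℂ}
    (h : V * W = 1) : IsZeroDimOfLength (traceProjIdeal W)
      (Module.finrank ℂ (MvPolynomial (Fin n) ℂ ⧸ traceIdeal n)) := by
  have := (finrank_quotient_traceIdeal_le (n := n)).1
  refine isZeroDimOfLength_projIdeal (isHomogeneous_linForm V 0) ?_ ?_
  · rw [aeval_mk_affineChart, aeval_affineChart_linForm h, Fin.cons_zero, map_one]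
  · intro x
    obtain ⟨f, rfl⟩ := Ideal.Quotient.mkₐ_surjective ℂ (traceIdeal n) x
    refine ⟨aeval (fun i => linForm V i.succ) f, ?_⟩
    rw [aeval_mk_affineChart, ← AlgHom.comp_apply (aeval (affineChart W)), comp_aeval]
    simp only [aeval_affineChart_linForm h, Fin.cons_succ]
    rw [aeval_X_left, AlgHom.id_apply]

end TangentQuadric

/-! ### Polynomials vanishing at the points of the smoothing -/

section Smoothing

variable {n : ℕ}

theorem coeff_single_one_mul_X {R : Type*} [CommRing R] (p : MvPolynomial (Fin n) R)
    (i j : Fin n) : coeff (Finsupp.single i 1) (p * X j) = if i = j then coeff 0 p else 0 := by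
  rw [coeff_mul_X']
  by_cases h : i = j
  · subst h; simp
  · simp [h, Ne.symm h]

theorem coeff_single_two_mul_X {R : Type*} [CommRing R] (p : MvPolynomial (Fin n) R)
    (i j : Fin n) : coeff (Finsupp.single i 2) (p * X j) =
      if i = j then coeff (Finsupp.single i 1) p else 0 := by
  rw [coeff_mul_X']
  by_cases h : i = j
  · subst h; simp [← Finsupp.single_tsub]
  · simp [h, Ne.symm h]

theorem coeff_zero_mul_X {R : Type*} [CommRing R] (p : MvPolynomial (Fin n) R)
    (j : Fin n) : coeff 0 (p * X j) = 0 := by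
  rw [← constantCoeff_eq, map_mul, constantCoeff_X, mul_zero]

theorem exists_eval_smul_eq {R : Type*} [CommRing R] (f : MvPolynomial (Fin n) R) (c : R)
    (x : Fin n → R) : ∃ e, eval (c • x) f =
      coeff 0 f + c * ∑ i, coeff (Finsupp.single i 1) f * x i + c ^ 2 * e := by
  induction f using MvPolynomial.induction_on with
  | C a => exact ⟨0, by simp [coeff_C, eq_comm]⟩
  | add p q hp hq =>
    obtain ⟨e, he⟩ := hp
    obtain ⟨e', he'⟩ := hq
    refine ⟨e + e', ?_⟩
    simp only [map_add, he, he', coeff_add, add_mul, Finset.sum_add_distrib]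
    ring
  | mul_X p j hp =>
    obtain ⟨e, he⟩ := hp
    refine ⟨(∑ i, coeff (Finsupp.single i 1) p * x i) * x j + c * e * x j, ?_⟩
    simp only [map_mul, he, eval_X, coeff_zero_mul_X, coeff_single_one_mul_X, ite_mul, zero_mul,
      Finset.sum_ite_eq', Finset.mem_univ, if_true, Pi.smul_apply, smul_eq_mul]
    ring

theorem exists_eval_single_eq {R : Type*} [CommRing R] (f : MvPolynomial (Fin n) R) (c : R)
    (i : Fin n) : ∃ e, eval (Pi.single i c) f = coeff 0 f + c * coeff (Finsupp.single i 1) f +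
      c ^ 2 * coeff (Finsupp.single i 2) f + c ^ 3 * e := by
  induction f using MvPolynomial.induction_on with
  | C a => exact ⟨0, by simp [coeff_C, eq_comm]⟩
  | add p q hp hq =>
    obtain ⟨e, he⟩ := hp
    obtain ⟨e', he'⟩ := hq
    refine ⟨e + e', ?_⟩
    simp only [map_add, he, he', coeff_add]
    ring
  | mul_X p j hp =>
    obtain ⟨e, he⟩ := hp
    by_cases h : i = j
    · refine ⟨coeff (Finsupp.single i 2) p + c * e, ?_⟩
      subst h
      simp only [map_mul, he, eval_X, coeff_zero_mul_X, coeff_single_one_mul_X,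
        coeff_single_two_mul_X, if_true, Pi.single_eq_same]
      ring
    · refine ⟨0, ?_⟩
      simp [coeff_zero_mul_X, coeff_single_one_mul_X, coeff_single_two_mul_X, h]

/-- The `n + 2` points `0`, `-t ^ 2 (1, …, 1)` and `t e_i` of affine `n`-space over `ℂ⟦t⟧`. -/
noncomputable def smoothingPoint : Option (Option (Fin n)) → Fin n → PowerSeries ℂ
  | none => 0
  | some none => (PowerSeries.X ^ 2 : PowerSeries ℂ) • fun _ => (-1 : PowerSeries ℂ)
  | some (some i) => Pi.single i PowerSeries.X

/-- Polynomials over `ℂ⟦t⟧` vanishing at the `n + 2` points reduce modulo `t` to elements of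
`traceIdeal n`. Indeed `∑_i (f(t e_i) - f(0)) / t ^ 2 + (f(- t ^ 2 (1, …, 1)) - f(0)) / t ^ 3` is
congruent to the trace of the quadratic part of `f`. -/
theorem map_mem_traceIdeal {f : MvPolynomial (Fin n) (PowerSeries ℂ)}
    (hf : ∀ p, eval (smoothingPoint p) f = 0) :
    map (PowerSeries.constantCoeff (R := ℂ)) f ∈ traceIdeal n := by
  have hX : (PowerSeries.X : PowerSeries ℂ) ≠ 0 := PowerSeries.X_ne_zero
  have h0 : coeff 0 f = 0 := by
    have h := hf none
    rwa [smoothingPoint, eval_zero, constantCoeff_eq] at h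
  choose e he using fun i => exists_eval_single_eq f PowerSeries.X i
  obtain ⟨e', he'⟩ := exists_eval_smul_eq f (PowerSeries.X ^ 2) fun _ => -1
  have h1 : ∀ i, coeff (Finsupp.single i 1) f =
      -(PowerSeries.X * (coeff (Finsupp.single i 2) f + PowerSeries.X * e i)) := by
    intro i
    have h := hf (some (some i))
    rw [smoothingPoint, he i, h0] at h
    refine mul_left_cancel₀ hX ?_
    linear_combination h
  have h2 : ∑ i, coeff (Finsupp.single i 1) f = PowerSeries.X ^ 2 * e' := by
    have h := hf (some none)
    rw [smoothingPoint, he', h0] at h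
    simp only [mul_neg, mul_one, Finset.sum_neg_distrib] at h
    refine mul_left_cancel₀ (pow_ne_zero 2 hX) ?_
    linear_combination -h
  have h3 : ∑ i, coeff (Finsupp.single i 2) f = -(PowerSeries.X * (∑ i, e i + e')) := by
    simp only [h1, Finset.sum_neg_distrib, ← Finset.mul_sum, Finset.sum_add_distrib] at h2
    refine mul_left_cancel₀ hX ?_
    linear_combination -h2
  refine mem_traceIdeal.2 ⟨by rw [coeff_map, h0, map_zero], fun i => ?_, ?_⟩
  · rw [coeff_map, h1]; simp
  · simp only [coeff_map, ← map_sum, h3]; simp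

/-- Conversely, the values of an element of `traceIdeal n` at the `n + 2` points can be
interpolated by a polynomial of degree `2` that is divisible by `t`. -/
theorem exists_interpolation {f : MvPolynomial (Fin n) ℂ} (hf : f ∈ traceIdeal n) (i₀ : Fin n) :
    ∃ (h : Fin n → PowerSeries ℂ) (s : PowerSeries ℂ), ∀ p,
      eval (smoothingPoint p) (map PowerSeries.C f) = PowerSeries.X *
        (∑ i, h i * smoothingPoint p i +
          s * (smoothingPoint p i₀ ^ 2 - PowerSeries.X * smoothingPoint p i₀)) := by
  obtain ⟨h0, h1, h2⟩ := mem_traceIdeal.1 hf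
  set g := map (PowerSeries.C (R := ℂ)) f with hg
  have g0 : coeff 0 g = 0 := by rw [hg, coeff_map, h0, map_zero]
  have g1 : ∀ i, coeff (Finsupp.single i 1) g = 0 := fun i => by
    rw [hg, coeff_map, h1, map_zero]
  have g2 : ∑ i, coeff (Finsupp.single i 2) g = 0 := by
    simp only [hg, coeff_map, ← map_sum, h2, map_zero]
  choose e he using fun i => exists_eval_single_eq g PowerSeries.X i
  obtain ⟨e', he'⟩ := exists_eval_smul_eq g (PowerSeries.X ^ 2) fun _ => -1
  obtain ⟨u, hu⟩ : ∃ u : PowerSeries ℂ, (1 + PowerSeries.X) * u = 1 := by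
    have : IsUnit (1 + PowerSeries.X : PowerSeries ℂ) := by
      rw [PowerSeries.isUnit_iff_constantCoeff]; simp
    exact this.exists_right_inv
  -- the values at `t e_i` determine the linear coefficients; the quadratic term vanishes at these
  -- points and corrects the value at the remaining point, where it equals `t ^ 3 (1 + t)`
  refine ⟨fun i => coeff (Finsupp.single i 2) g + PowerSeries.X * e i, (e' + ∑ i, e i) * u, ?_⟩
  rintro (_ | _ | i)
  · simp [smoothingPoint, eval_zero, constantCoeff_eq, g0]
  · have hs : ∑ i, (coeff (Finsupp.single i 2) g + PowerSeries.X * e i) =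
        PowerSeries.X * ∑ i, e i := by
      rw [Finset.sum_add_distrib, g2, zero_add, Finset.mul_sum]
    simp only [smoothingPoint, he', g0, g1, zero_mul, Finset.sum_const_zero, mul_zero, zero_add,
      Pi.smul_apply, smul_eq_mul, ← Finset.sum_mul, hs]
    linear_combination -(PowerSeries.X ^ 4 * (e' + ∑ i, e i)) * hu
  · simp only [smoothingPoint, he, g0, g1]
    simp only [Pi.single_apply, mul_ite, mul_zero, Finset.sum_ite_eq', Finset.mem_univ, if_true]
    split_ifs <;> ring

end Smoothing

/-! ### Ideals of points over a domain and its fraction field -/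

section PointsIdeal

variable {n : ℕ} {R S : Type*} [CommRing R] [CommRing S] {ι : Type*}

/-- The homogeneous ideal of a family of points `x` of affine `n`-space, in the chart given
by `W`. -/
noncomputable def pointsIdeal (W : Matrix (Fin (n + 1)) (Fin (n + 1)) R) (x : ι → Fin n → R) :
    Ideal (CoordRing R n) :=
  projIdeal (A := ι → R) fun j p => eval (x p) (affineChart W j)

theorem aeval_points (W : Matrix (Fin (n + 1)) (Fin (n + 1)) R) (x : ι → Fin n → R)
    (g : CoordRing R n) (p : ι) : aeval (R := R) (fun j p => eval (x p) (affineChart W j)) g p =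
      eval (x p) (aeval (affineChart W) g) := by
  have h : (Pi.evalAlgHom R (fun _ : ι => R) p).comp
      (aeval (R := R) fun j p => eval (x p) (affineChart W j)) =
      (aeval (x p)).comp (aeval (affineChart W)) := by
    ext j
    simp
  exact congrArg (fun φ => φ g) h

theorem mem_pointsIdeal {W : Matrix (Fin (n + 1)) (Fin (n + 1)) R} {x : ι → Fin n → R}
    {g : CoordRing R n} : g ∈ pointsIdeal W x ↔
      ∀ d p, eval (x p) (aeval (affineChart W) (homogeneousComponent d g)) = 0 := by
  simp only [pointsIdeal, mem_projIdeal, funext_iff, aeval_points, Pi.zero_apply]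

theorem mem_pointsIdeal_of_isHomogeneous {W : Matrix (Fin (n + 1)) (Fin (n + 1)) R}
    {x : ι → Fin n → R} {g : CoordRing R n} {d : ℕ} (hg : g.IsHomogeneous d) :
    g ∈ pointsIdeal W x ↔ ∀ p, eval (x p) (aeval (affineChart W) g) = 0 := by
  simp only [pointsIdeal, mem_projIdeal_of_isHomogeneous hg, funext_iff, aeval_points,
    Pi.zero_apply]

theorem isSubschemeIdeal_pointsIdeal {V W : Matrix (Fin (n + 1)) (Fin (n + 1)) R} (h : V * W = 1)
    (x : ι → Fin n → R) : IsSubschemeIdeal (pointsIdeal W x) := by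
  refine isSubschemeIdeal_projIdeal (isHomogeneous_linForm V 0) ?_
  ext p
  rw [aeval_points, aeval_affineChart_linForm h, Fin.cons_zero, map_one, Pi.one_apply]

theorem map_homogeneousComponent (ρ : R →+* S) (g : CoordRing R n) (d : ℕ) :
    homogeneousComponent d (map ρ g) = map ρ (homogeneousComponent d g) := by
  ext m
  simp only [coeff_homogeneousComponent, coeff_map, apply_ite ρ, map_zero]

theorem map_aeval_affineChart (ρ : R →+* S) (W : Matrix (Fin (n + 1)) (Fin (n + 1)) R)
    (g : CoordRing R n) : map ρ (aeval (affineChart W) g) =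
      aeval (affineChart (W.map ρ)) (map ρ g) := by
  induction g using MvPolynomial.induction_on with
  | C a => simp [algebraMap_eq]
  | add p q hp hq => simp only [map_add, hp, hq]
  | mul_X p j hp =>
    have h : map ρ (affineChart W j) = affineChart (W.map ρ) j := by
      simp only [affineChart, map_sum, map_mul, map_C, Matrix.map_apply]
      refine Finset.sum_congr rfl fun i _ => ?_
      congr 1
      refine Fin.cases ?_ (fun i => ?_) i <;> simp
    simp only [map_mul, hp, map_X, aeval_X, h]

theorem map_mem_pointsIdeal_iff {ρ : R →+* S} (hρ : Function.Injective ρ)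
    {W : Matrix (Fin (n + 1)) (Fin (n + 1)) R} {x : ι → Fin n → R} {g : CoordRing R n} :
    map ρ g ∈ pointsIdeal (W.map ρ) (fun p => ρ ∘ x p) ↔ g ∈ pointsIdeal W x := by
  have h : ∀ (y : Fin n → R) (f : MvPolynomial (Fin n) R),
      eval (ρ ∘ y) (map ρ f) = ρ (eval y f) := fun y f => by
    induction f using MvPolynomial.induction_on with
    | C a => simp
    | add p q hp hq => simp only [map_add, hp, hq]
    | mul_X p j hp => simp only [map_mul, hp, map_X, eval_X, Function.comp_apply]
  simp only [mem_pointsIdeal, map_homogeneousComponent, ← map_aeval_affineChart, h,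
    map_eq_zero_iff ρ hρ]

theorem isRadical_pointsIdeal [IsDomain R] (W : Matrix (Fin (n + 1)) (Fin (n + 1)) R)
    (x : ι → Fin n → R) : (pointsIdeal W x).IsRadical := by
  rintro g ⟨m, hm⟩
  rw [pointsIdeal, projIdeal, RingHom.mem_ker, map_pow] at hm
  rw [pointsIdeal, projIdeal, RingHom.mem_ker]
  ext d p
  have h := congrArg (Polynomial.map (Pi.evalRingHom (fun _ : ι => R) p)) hm
  rw [Polynomial.map_pow, Polynomial.map_zero] at h
  simpa using congrArg (fun q => q.coeff d) (eq_zero_of_pow_eq_zero h)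

theorem flat_quotient_pointsIdeal [IsDomain R] [IsDedekindRing R]
    (W : Matrix (Fin (n + 1)) (Fin (n + 1)) R) (x : ι → Fin n → R) :
    Module.Flat R (CoordRing R n ⧸ pointsIdeal W x) := by
  have : Module.IsTorsionFree R (CoordRing R n ⧸ pointsIdeal W x) :=
    (RingHom.kerLift_injective
      (gradedAeval (R := R) (A := ι → R) fun j p => eval (x p) (affineChart W j)).toRingHom
      ).moduleIsTorsionFree _ fun r m => by
        obtain ⟨g, rfl⟩ := Ideal.Quotient.mk_surjective m
        exact map_smul (gradedAeval (R := R) (A := ι → R) fun j p => eval (x p) (affineChart W j))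
          r g
  infer_instance

/-- Over a domain, the ideal of a family of points generates over the fraction field the ideal of
the same points: denominators can be cleared. -/
theorem map_pointsIdeal_fractionRing (K : Type*) [Field K] [Algebra R K] [IsDomain R]
    [IsFractionRing R K] (W : Matrix (Fin (n + 1)) (Fin (n + 1)) R) (x : ι → Fin n → R) :
    (pointsIdeal W x).map (map (algebraMap R K)) =
      pointsIdeal (W.map (algebraMap R K)) fun p => algebraMap R K ∘ x p := by
  have hinj := IsFractionRing.injective R K
  refine le_antisymm (Ideal.map_le_iff_le_comap.2 fun g hg =>
    (map_mem_pointsIdeal_iff hinj).2 hg) fun g hg => ?_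
  let : Algebra (MvPolynomial (Fin (n + 1)) R) (MvPolynomial (Fin (n + 1)) K) :=
    algebraMvPolynomial
  obtain ⟨⟨g', _, r, hr, rfl⟩, h⟩ := IsLocalization.surj
    ((nonZeroDivisors R).map (C (σ := Fin (n + 1)))) g
  have h' : g * C (algebraMap R K r) = map (algebraMap R K) g' := by
    rw [← map_C]; exact h
  have hg' : g' ∈ pointsIdeal W x := by
    rw [← map_mem_pointsIdeal_iff hinj, ← h']
    exact Ideal.mul_mem_right _ _ hg
  have hr0 : algebraMap R K r ≠ 0 :=
    IsFractionRing.to_map_ne_zero_of_mem_nonZeroDivisors hr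
  have h2 : g = map (algebraMap R K) g' * C (algebraMap R K r)⁻¹ := by
    rw [← h', mul_assoc, ← C_mul, mul_inv_cancel₀ hr0, C_1, mul_one]
  rw [h2]
  exact Ideal.mul_mem_right _ _ (Ideal.mem_map_of_mem _ hg')

end PointsIdeal

/-! ### Smoothability -/

section Smoothable

variable {n : ℕ}

/-- The ideal over `ℂ⟦t⟧` of the `n + 2` points which degenerate to the local scheme defined by
`traceIdeal n`. -/
noncomputable def smoothingIdeal (W : Matrix (Fin (n + 1)) (Fin (n + 1)) ℂ) :
    Ideal (CoordRing (PowerSeries ℂ) n) :=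
  pointsIdeal (W.map PowerSeries.C) smoothingPoint

theorem matrix_map_C_map_constantCoeff (W : Matrix (Fin (n + 1)) (Fin (n + 1)) ℂ) :
    (W.map PowerSeries.C).map (PowerSeries.constantCoeff (R := ℂ)) = W := by
  ext i j; simp

theorem map_smoothingIdeal_le (W : Matrix (Fin (n + 1)) (Fin (n + 1)) ℂ) :
    (smoothingIdeal W).map (map (PowerSeries.constantCoeff (R := ℂ))) ≤ traceProjIdeal W := by
  refine Ideal.map_le_iff_le_comap.2 fun g hg => ?_
  rw [Ideal.mem_comap, mem_traceProjIdeal]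
  intro d
  rw [smoothingIdeal, mem_pointsIdeal] at hg
  have h1 := map_mem_traceIdeal (hg d)
  rw [map_aeval_affineChart, matrix_map_C_map_constantCoeff] at h1
  rwa [map_homogeneousComponent]

/-- In degrees at least `2` every form in the ideal of the limit scheme lifts to a form vanishing
at the `n + 2` points. -/
theorem mem_map_smoothingIdeal (hn : 0 < n) {V W : Matrix (Fin (n + 1)) (Fin (n + 1)) ℂ}
    (h : V * W = 1) {d : ℕ} {g : CoordRing ℂ n} (hg : g.IsHomogeneous (d + 2))
    (hgI : g ∈ traceProjIdeal W) :
    g ∈ (smoothingIdeal W).map (map (PowerSeries.constantCoeff (R := ℂ))) := by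
  have hg0 : aeval (affineChart W) g ∈ traceIdeal n := by
    have h1 := mem_traceProjIdeal.1 hgI (d + 2)
    rwa [homogeneousComponent_of_mem hg, if_pos rfl] at h1
  let i₀ : Fin n := ⟨0, hn⟩
  obtain ⟨u, s, hus⟩ := exists_interpolation hg0 i₀
  have hR : V.map (PowerSeries.C (R := ℂ)) * W.map PowerSeries.C = 1 := by
    rw [← Matrix.map_mul, h, Matrix.map_one _ (map_zero _) (map_one _)]
  obtain ⟨z, hz, h0, hs⟩ : ∃ z : Fin (n + 1) → CoordRing (PowerSeries ℂ) n,
      (∀ i, (z i).IsHomogeneous 1) ∧ aeval (affineChart (W.map PowerSeries.C)) (z 0) = 1 ∧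
      ∀ i : Fin n, aeval (affineChart (W.map PowerSeries.C)) (z i.succ) = X i :=
    ⟨linForm (V.map PowerSeries.C), isHomogeneous_linForm _, aeval_affineChart_linForm hR 0,
      fun i => aeval_affineChart_linForm hR i.succ⟩
  obtain ⟨q, hq, hqa⟩ : ∃ q : CoordRing (PowerSeries ℂ) n, q.IsHomogeneous (d + 2) ∧
      aeval (affineChart (W.map PowerSeries.C)) q = ∑ i, C (u i) * X i +
        C s * (X i₀ ^ 2 - C PowerSeries.X * X i₀) := by
    have hzz : ∀ i j, (z i * z j).IsHomogeneous 2 := fun i j => (hz i).mul (hz j)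
    refine ⟨z 0 ^ d * (∑ i, C (u i) * (z 0 * z i.succ) +
        C s * (z i₀.succ * z i₀.succ - C PowerSeries.X * (z 0 * z i₀.succ))), ?_, ?_⟩
    · have h1 : (z 0 ^ d).IsHomogeneous d := by simpa using (hz 0).pow d
      exact h1.mul ((IsHomogeneous.sum _ _ _ fun i _ => (hzz 0 i.succ).C_mul (u i)).add
        (((hzz _ _).sub ((hzz 0 i₀.succ).C_mul _)).C_mul s))
    · simp only [map_mul, map_add, map_sub, map_pow, map_sum, aeval_C, algebraMap_eq, h0, hs,
        one_pow, one_mul, pow_two]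
  have hmem : map PowerSeries.C g - C PowerSeries.X * q ∈ smoothingIdeal W := by
    refine (mem_pointsIdeal_of_isHomogeneous ((hg.map _).sub (hq.C_mul _))).2 fun p => ?_
    have h1 := hus p
    rw [map_aeval_affineChart] at h1
    rw [map_sub, map_mul, aeval_C, algebraMap_eq, hqa, map_sub, h1, map_mul, eval_C]
    simp only [map_add, map_sum, map_mul, map_sub, map_pow, eval_C, eval_X, sub_self]
  have hmap : map (PowerSeries.constantCoeff (R := ℂ))
      (map PowerSeries.C g - C PowerSeries.X * q) = g := by
    have hρ : (PowerSeries.constantCoeff (R := ℂ)).comp PowerSeries.C = RingHom.id ℂ :=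
      RingHom.ext fun a => by simp
    rw [map_sub, map_mul, map_C, map_map, hρ, map_id, PowerSeries.constantCoeff_X, C_0, zero_mul,
      sub_zero]
  rw [← hmap]
  exact Ideal.mem_map_of_mem _ hmem

theorem homogeneousComponent_eq_zero_of_mem_pow {p : CoordRing ℂ n} {m d : ℕ}
    (hp : p ∈ irrelevantIdeal ℂ n ^ m) (hd : d < m) : homogeneousComponent d p = 0 := by
  ext x
  rw [coeff_homogeneousComponent, coeff_zero]
  split_ifs with hx
  · exact (mem_pow_idealOfVars_iff' m p).1 hp x (by omega)
  · rfl

theorem isSmoothable_traceProjIdeal (hn : 0 < n) {V W : Matrix (Fin (n + 1)) (Fin (n + 1)) ℂ}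
    (h : V * W = 1) : IsSmoothable (traceProjIdeal W) := by
  have hR : V.map (PowerSeries.C (R := ℂ)) * W.map PowerSeries.C = 1 := by
    rw [← Matrix.map_mul, h, Matrix.map_one _ (map_zero _) (map_one _)]
  have hsub : IsSubschemeIdeal (traceProjIdeal W) := (isZeroDimOfLength_traceProjIdeal h).1
  refine ⟨smoothingIdeal W, isSubschemeIdeal_pointsIdeal hR _,
    flat_quotient_pointsIdeal _ _, le_antisymm ?_ ?_, ?_⟩
  · conv_rhs => rw [← hsub.2]
    exact saturation_mono (map_smoothingIdeal_le W)
  · refine fun g hg => ⟨2, fun p hp => ?_⟩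
    rw [← sum_homogeneousComponent (p * g)]
    refine Ideal.sum_mem _ fun d _ => ?_
    rcases lt_or_ge d 2 with hd | hd
    · rw [homogeneousComponent_eq_zero_of_mem_pow (Ideal.mul_mem_right g _ hp) hd]
      exact Ideal.zero_mem _
    · obtain ⟨e, rfl⟩ := Nat.exists_eq_add_of_le' hd
      exact mem_map_smoothingIdeal hn h (homogeneousComponent_isHomogeneous _ _)
        (hsub.1 _ (Ideal.mul_mem_left _ _ hg) _)
  · rw [smoothingIdeal, map_pointsIdeal_fractionRing]
    exact isRadical_pointsIdeal _ _

end Smoothable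

/-! ### The cactus rank of cubic forms -/

theorem theorem2 (n : ℕ) :
    HoldsForGeneral (cubicForms n) (fun F => cactusRank F ≤ 2 * (n : ℕ∞) + 2) ∧
    (1 < n → HoldsForGeneral (reducibleCubicForms n)
      (fun F => cactusRank F = (n : ℕ∞) + 2 ∧ smoothableRank F = (n : ℕ∞) + 2)) := by
  refine ⟨⟨X (Finsupp.single 0 3), ⟨X 0 ^ 3, ?_, ?_⟩, fun F hF hP => ?_⟩, fun hn => ?_⟩
  · change IsHomogeneous _ _
    simpa using (isHomogeneous_X ℂ (0 : Fin (n + 1))).pow 3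
  · rw [eval_X, coeff_X_pow]
    simp
  · rw [eval_X] at hP
    exact cactusRank_le_of_coeff_ne_zero hF hP
  · obtain ⟨P, hP, hgen⟩ := holdsForGeneral_isNormalized hn
    refine ⟨P, hP, fun F hF hPF => ?_⟩
    obtain ⟨V, W, c, hnorm⟩ := hgen F hF hPF
    have hlow : (n : ℕ∞) + 2 ≤ cactusRank F := le_iInf₂ fun r ⟨I, hI, hIF⟩ => by
      exact_mod_cast hnorm.le_length hn hI hIF
    have hle : cactusRank F ≤ smoothableRank F := le_iInf₂ fun r ⟨I, hI, _, hIF⟩ =>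
      iInf₂_le r ⟨I, hI, hIF⟩
    have hup : smoothableRank F ≤ (n : ℕ∞) + 2 :=
      (iInf₂_le _ ⟨traceProjIdeal W, isZeroDimOfLength_traceProjIdeal hnorm.mul_eq_one,
        isSmoothable_traceProjIdeal (by omega) hnorm.mul_eq_one, hnorm.isApolar hF.1⟩).trans
        (by exact_mod_cast finrank_quotient_traceIdeal_le.2)
    exact ⟨le_antisymm (hle.trans hup) hlow, le_antisymm hup (hlow.trans hle)⟩
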